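/- **Setting.** Let $G=(V,E)$ be a finite connected undirected graph (parallel edges and loops allowed) with resistances $r:E\to\mathbb R_{>0}$ such that $\sum_{e\in E}1/r_e=1/2$. Write $r_v=\big[\sum_{e\ni v}1/r_e\big]^{-1}$, let $P$ with $P_{vw}=\sum_{e\text{ joining }v,w}r_v/r_e$ be the transition matrix of the random walk on $G$, and let $\pi_v\propto 1/r_v$ be its stationary distribution. Let $t\ge1$ be an integer. For $\delta\in\mathbb R^V$, $R_{\mathrm{eff}}(P^t;\delta)$ is the minimal energy $\sum_e f_e^2\rho_e$ of a flow $f$ with net-flow (outflow minus inflow) $\delta$ on the graph with an edge $\{v,w\}$ of resistance $\rho_{\{v,w\}}=1/(\pi_v(P^t)_{vw})$ whenever $(P^t)_{vw}>0$, and it is $\infty$ if there is no such flow. For a probability distribution $\sigma$ on $V$ and $M\subseteq V$, $R_{\mathrm{eff}}(P^t;\sigma\leftrightarrow M)$ is the minimum of $R_{\mathrm{eff}}(P^t;\sigma-\nu)$ over the probability distributions $\nu$ on $V$ that vanish outside $M$. *Routines.* Let $\mathcal D$ be a finite set. Let $(O_x)_{x\in\mathcal D}$ be unitaries with $O_x^2=I$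 on a finite-dimensional space $\mathcal M$, let $B$ be a finite set, and let $\xi,\eta:\mathcal D\to B$. Put $|\sigma_x^{+}\rangle=|\xi_x\rangle-|\eta_x\rangle$ and $|\sigma_x^{-}\rangle=|\xi_x\rangle+|\eta_x\rangle$ in $\mathbb C^B$. A *hyperedge that computes $\eta_x$ from $\xi_x$* is a family of vectors $|w_x^\pm\rangle\in\mathcal M\otimes\mathcal W$, for an inner product space $\mathcal W$, with $(O_x\otimes I)|w_x^\pm\rangle=\pm|w_x^\pm\rangle$ that is a feasible solution of the adversary bound for the conversion of $|\sigma_x^\pm\rangle$ into $\pm|\sigma_x^\pm\rangle$, i.e., for all $x,y\in\mathcal D$ and all signs $a,b$, $\langle\sigma_x^a|\sigma_y^b\rangle-ab\langle\sigma_x^a|\sigma_y^b\rangle=\langle w_x^a|\big((I-O_x^\dagger O_y)\otimes I\big)|w_y^b\rangle$. Its positive and negative witness sizes for $x$ are $\||w_x^{\pm}\rangle\|^2$. A *span program* on $\mathcal D$ in a complex inner product space $\mathcal H$ consists of subspaces $\mathcal H(x)\subseteq\mathcal H$ for $x\in\mathcal D$, a subspace $\mathcal K\subseteq\mathcal H$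 and a vector $|w_0\rangle\in\mathcal K^\perp$. A positive witness for $x$ is a vector $w\in\mathcal H(x)$ with $w-w_0\in\mathcal K$; a negative witness for $x$ is a vector $w\in\mathcal H(x)^\perp\cap\mathcal K^\perp$ with $\langle w_0|w\rangle=1$; $x$ is a positive (negative) input if it has a positive (negative) witness. The positive (negative) witness size of $x$ is the infimum of $\|w\|^2$ over these witnesses $w$ (a minimum in finite dimension), and it is $0$ if there is none. The complexity is $C(\mathcal P)=\sqrt{W_+W_-}$, where $W_\pm$ is the maximum of the positive, respectively negative, witness sizes over the positive, respectively negative, inputs ($0$ if there are none). *Instance.* For each $x\in\mathcal D$ let $M_x\subseteq V$ be the set of marked vertices, and for each $v\in V$ let $D_{v,x}$ be an element of a finite set $\mathcal S$. We are given, each with its own oracle, workspace and witness sizes: * for each $v\in V$, a setup hyperedge $S_v$ that computes $D_{v,x}$ from a constant source symbol; * for each $e\in E$, directed arbitrarily from $v$ to $w$, an update hyperedge $U_e$ that computes $(w,D_{w,x})$ from $(v,D_{v,x})$; * for each $v\in V$ and $D\in\mathcal S$, a checking span program $C_{v,D}$ such that every $x$ with $D_{v,x}=D$ is a positive input if $v\in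 M_x$ and a negative input if $v\notin M_x$. Let $\mathsf S^{\pm}=\max_{v,x}(\mathsf S_v)_x^\pm$, $\mathsf U^{\pm}=\max_{e,x}(\mathsf U_e)_x^\pm$ and $\mathsf C^{\pm}=\max_{v,x}(\mathsf C_{v,D_{v,x}})_x^\pm$ be the maximal positive and negative witness sizes, and let $\mathsf S=\sqrt{\mathsf S^+\mathsf S^-}$, $\mathsf U=\sqrt{\mathsf U^+\mathsf U^-}$ and $\mathsf C=\sqrt{\mathsf C^+\mathsf C^-}$. **Theorem.** There is a universal constant $c>0$ such that the following holds for every such instance, every probability distribution $\sigma$ on $V$, every integer $t\ge1$ and every real $R\ge0$. If $R_{\mathrm{eff}}(P^t;\sigma\leftrightarrow M_x)\le R$ for all $x\in\mathcal D$ with $M_x\ne\varnothing$, then there is a span program $\mathcal P$ on $\mathcal D$ that solves the detection problem, i.e., every $x$ with $M_x\neq\varnothing$ is a positive input of $\mathcal P$ and every $x$ with $M_x=\varnothing$ is a negative input, and whose complexity satisfies $$C(\mathcal P)\le c\,\big(\mathsf S+\sqrt{tR}\,\mathsf U+\sqrt{1+R}\,\mathsf C\big).$$ Moreover, $\mathcal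 P$ only uses the oracles of the routines: its space $\mathcal H$ is the orthogonal direct sum of the spaces of all the routines $S_v$, $U_e$ and $C_{v,D}$, and $\mathcal H(x)$ is the direct sum of the $+1$-eigenspaces of their oracles, where the oracle of a checking routine is the reflection through its own input-dependent subspace. -/

import Mathlib

open scoped TensorProduct ENNReal

noncomputable section

/-- A (finite) undirected graph with vertices `V` and edges `E`, where parallel edges and loops are
allowed. As usual for flows, every edge carries an implicit direction, from `tail e` to `head e`. -/
structure MultiGraph (V E : Type*) where
  tail : E → V
  head : E → V

namespace MultiGraph

variable {V E : Type*} (G : MultiGraph V E)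

/-- The edge `e` connects `v` and `w` (the direction of `e` is ignored). -/
def Joins (e : E) (v w : V) : Prop := s(G.tail e, G.head e) = s(v, w)

def IsConnected : Prop :=
  Nonempty V ∧ ∀ v w : V, Relation.ReflTransGen (fun a b => ∃ e, G.Joins e a b) v w

open Classical in
/-- The net-flow of `f`: at each vertex, the total outgoing flow minus the total incoming flow. -/
def netFlow [Fintype E] (f : E → ℝ) (v : V) : ℝ :=
  (∑ e with G.tail e = v, f e) - ∑ e with G.head e = v, f e

/-- The effective resistance of the net-flow `δ`: the minimal energy `∑ e, (f e) ^ 2 * r e` of a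
flow `f` with net-flow `δ`. It is `∞` if there is no such flow. -/
def effectiveResistance [Fintype E] (r : E → ℝ) (δ : V → ℝ) : ℝ≥0∞ :=
  ⨅ f ∈ {f : E → ℝ | G.netFlow f = δ}, ENNReal.ofReal (∑ e, f e ^ 2 * r e)

open Classical in
/-- `r_v`, the inverse of the total conductance of the edges that are incident to `v`. -/
def vertexResistance [Fintype E] (r : E → ℝ) (v : V) : ℝ :=
  (∑ e with G.tail e = v ∨ G.head e = v, 1 / r e)⁻¹

open Classical in
/-- The transition matrix of the random walk on `G` with resistances `r`. -/
def walkMatrix [Fintype E] (r : E → ℝ) : Matrix V V ℝ :=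
  fun v w => ∑ e with G.Joins e v w, G.vertexResistance r v / r e

/-- The stationary distribution of the random walk on `G` with resistances `r`; its value at `v` is
proportional to `1 / r_v`. -/
def stationary [Fintype V] [Fintype E] (r : E → ℝ) (v : V) : ℝ :=
  (∑ u, 1 / G.vertexResistance r u)⁻¹ / G.vertexResistance r v

end MultiGraph

section Markov

variable {V : Type*}

/-- The undirected graph of a reversible Markov process with transition matrix `P`. Its edges are
the unordered pairs `{v, w}` with `P v w > 0`, the case `v = w` included; the direction of an edge
is arbitrary. By detailed balance, `P v w > 0` does not depend on the order of `v` and `w`. -/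
def transitionGraph (P : Matrix V V ℝ) :
    MultiGraph V {e : Sym2 V // 0 < P (Quot.out e).1 (Quot.out e).2} where
  tail e := (Quot.out e.1).1
  head e := (Quot.out e.1).2

/-- The resistance `1 / (π v * P v w)` of the edge `{v, w}`, which by detailed balance does not
depend on the order of `v` and `w`. -/
def transitionResistance (P : Matrix V V ℝ) (π : V → ℝ)
    (e : {e : Sym2 V // 0 < P (Quot.out e).1 (Quot.out e).2}) : ℝ :=
  1 / (π (Quot.out e.1).1 * P (Quot.out e.1).1 (Quot.out e.1).2)

/-- `R_eff(P; δ)` for a Markov process `P` that is reversible with respect to `π`. -/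
def markovResistance [Fintype V] (P : Matrix V V ℝ) (π : V → ℝ) (δ : V → ℝ) : ℝ≥0∞ :=
  haveI : Fintype {e : Sym2 V // 0 < P (Quot.out e).1 (Quot.out e).2} := Fintype.ofFinite _
  (transitionGraph P).effectiveResistance (transitionResistance P π) δ

/-- `R_eff(P; μ ↔ M)`: the minimum of `R_eff(P; μ - ν)` over all probability distributions `ν` that
vanish outside `M`. -/
def markovResistanceToSet [Fintype V] (P : Matrix V V ℝ) (π : V → ℝ) (μ : V → ℝ) (M : Set V) :
    ℝ≥0∞ :=
  ⨅ ν ∈ {ν : V → ℝ | ν ∈ stdSimplex ℝ V ∧ ∀ v ∉ M, ν v = 0}, markovResistance P π (μ - ν)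

end Markov

/-- A state-conversion problem: for each index `i`, convert `source i` into `target i` with access
to the operation `oracle i`. -/
structure StateConversion (I 𝒱 ℳ : Type*) [AddCommGroup ℳ] [Module ℂ ℳ] where
  source : I → 𝒱
  target : I → 𝒱
  oracle : I → ℳ →ₗ[ℂ] ℳ

/-- The constraints of the adversary bound for the state-conversion problem `P`, with workspace `𝒲`:
`⟨σ i, σ j⟩ - ⟨τ i, τ j⟩ = ⟨w i, ((1 - (O i)† * O j) ⊗ 1) (w j)⟩`. -/
def StateConversion.IsFeasible {I 𝒱 ℳ 𝒲 : Type*}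
    [NormedAddCommGroup 𝒱] [InnerProductSpace ℂ 𝒱]
    [NormedAddCommGroup ℳ] [InnerProductSpace ℂ ℳ] [FiniteDimensional ℂ ℳ]
    [NormedAddCommGroup 𝒲] [InnerProductSpace ℂ 𝒲]
    (P : StateConversion I 𝒱 ℳ) (w : I → ℳ ⊗[ℂ] 𝒲) : Prop :=
  ∀ i j, inner ℂ (P.source i) (P.source j) - inner ℂ (P.target i) (P.target j) =
    inner ℂ (w i)
      (LinearMap.rTensor 𝒲 (1 - LinearMap.adjoint (P.oracle i) * P.oracle j) (w j))

/-- A state-reflection problem: reflect, i.e., map `pos x` to `pos x` and `neg x` to `-neg x`, given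
access to a unitary `oracle x` that squares to the identity. -/
structure StateReflection (𝒟 𝒱 ℳ : Type*)
    [NormedAddCommGroup 𝒱] [InnerProductSpace ℂ 𝒱]
    [NormedAddCommGroup ℳ] [InnerProductSpace ℂ ℳ] [FiniteDimensional ℂ ℳ] where
  pos : 𝒟 → 𝒱
  neg : 𝒟 → 𝒱
  oracle : 𝒟 → ℳ →ₗ[ℂ] ℳ
  inner_pos_neg : ∀ x, inner ℂ (pos x) (neg x) = 0
  oracle_unitary : ∀ x, LinearMap.adjoint (oracle x) * oracle x = 1
  oracle_sq : ∀ x, oracle x * oracle x = 1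

namespace StateReflection

variable {𝒟 𝒱 ℳ : Type*}
  [NormedAddCommGroup 𝒱] [InnerProductSpace ℂ 𝒱]
  [NormedAddCommGroup ℳ] [InnerProductSpace ℂ ℳ] [FiniteDimensional ℂ ℳ]

/-- A state-reflection problem as a state-conversion problem. The instances `Sum.inl x` are the
positive ones, and the instances `Sum.inr x` are the negative ones. -/
def toStateConversion (R : StateReflection 𝒟 𝒱 ℳ) : StateConversion (𝒟 ⊕ 𝒟) 𝒱 ℳ where
  source := Sum.elim R.pos R.neg
  target := Sum.elim R.pos (-R.neg)
  oracle := Sum.elim R.oracle R.oracle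

/-- The `+1`-eigenspace of `oracle x ⊗ 1`. -/
def plusSpace (R : StateReflection 𝒟 𝒱 ℳ) (𝒲 : Type*) [NormedAddCommGroup 𝒲]
    [InnerProductSpace ℂ 𝒲] (x : 𝒟) : Submodule ℂ (ℳ ⊗[ℂ] 𝒲) :=
  Module.End.eigenspace (LinearMap.rTensor 𝒲 (R.oracle x)) 1

/-- A feasible solution of a state-reflection problem, whose positive and negative witnesses are in
the `+1`- and `-1`-eigenspaces of the oracle, respectively. -/
structure Solution (R : StateReflection 𝒟 𝒱 ℳ) (𝒲 : Type*) [NormedAddCommGroup 𝒲]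
    [InnerProductSpace ℂ 𝒲] where
  posWitness : 𝒟 → ℳ ⊗[ℂ] 𝒲
  negWitness : 𝒟 → ℳ ⊗[ℂ] 𝒲
  feasible : R.toStateConversion.IsFeasible (Sum.elim posWitness negWitness)
  oracle_posWitness : ∀ x, LinearMap.rTensor 𝒲 (R.oracle x) (posWitness x) = posWitness x
  oracle_negWitness : ∀ x, LinearMap.rTensor 𝒲 (R.oracle x) (negWitness x) = -negWitness x

/-- The positive witness size of a solution for the input `x`. -/
def Solution.posSize {R : StateReflection 𝒟 𝒱 ℳ} {𝒲 : Type*} [NormedAddCommGroup 𝒲]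
    [InnerProductSpace ℂ 𝒲] (w : R.Solution 𝒲) (x : 𝒟) : ℝ := ‖w.posWitness x‖ ^ 2

/-- The negative witness size of a solution for the input `x`. -/
def Solution.negSize {R : StateReflection 𝒟 𝒱 ℳ} {𝒲 : Type*} [NormedAddCommGroup 𝒲]
    [InnerProductSpace ℂ 𝒲] (w : R.Solution 𝒲) (x : 𝒟) : ℝ := ‖w.negWitness x‖ ^ 2

end StateReflection

/-- A family of unitary operations that square to the identity. -/
structure ReflectionOracle (𝒟 ℳ : Type*)
    [NormedAddCommGroup ℳ] [InnerProductSpace ℂ ℳ] [FiniteDimensional ℂ ℳ] where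
  op : 𝒟 → ℳ →ₗ[ℂ] ℳ
  unitary : ∀ x, LinearMap.adjoint (op x) * op x = 1
  sq : ∀ x, op x * op x = 1

/-- A hyperedge problem on a finite set `B` of vertices: a state-reflection problem on `ℂ^B` whose
positive states are net-flows and whose negative states are potential functions. -/
structure HyperedgeProblem (𝒟 B ℳ : Type*) [Fintype B]
    [NormedAddCommGroup ℳ] [InnerProductSpace ℂ ℳ] [FiniteDimensional ℂ ℳ] where
  flow : 𝒟 → EuclideanSpace ℂ B
  potential : 𝒟 → EuclideanSpace ℂ B
  oracle : ReflectionOracle 𝒟 ℳ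
  potential_const : ∀ x u v, flow x u ≠ 0 → flow x v ≠ 0 → potential x u = potential x v
  sum_flow : ∀ x, ∑ v, flow x v = 0

namespace HyperedgeProblem

variable {𝒟 B ℳ : Type*} [Fintype B]
  [NormedAddCommGroup ℳ] [InnerProductSpace ℂ ℳ] [FiniteDimensional ℂ ℳ]

theorem inner_flow_potential (R : HyperedgeProblem 𝒟 B ℳ) (x : 𝒟) :
    inner ℂ (R.flow x) (R.potential x) = 0 := by
  rw [PiLp.inner_apply]
  by_cases h : ∃ u, R.flow x u ≠ 0
  · obtain ⟨u, hu⟩ := h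
    have key : ∀ v, inner ℂ (R.flow x v) (R.potential x v)
        = R.potential x u * (starRingEnd ℂ) (R.flow x v) := by
      intro v
      by_cases hv : R.flow x v = 0
      · simp [hv]
      · rw [R.potential_const x u v hu hv]
        rfl
    rw [Finset.sum_congr rfl fun v _ => key v, ← Finset.mul_sum, ← map_sum, R.sum_flow x]
    simp
  · push Not at h
    simp [h]

/-- A hyperedge problem as a state-reflection problem. -/
def toStateReflection (R : HyperedgeProblem 𝒟 B ℳ) :
    StateReflection 𝒟 (EuclideanSpace ℂ B) ℳ where
  pos := R.flow
  neg := R.potential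
  oracle := R.oracle.op
  inner_pos_neg := R.inner_flow_potential
  oracle_unitary := R.oracle.unitary
  oracle_sq := R.oracle.sq

open Classical in
/-- The hyperedge problem that computes (or updates) `ξ x` to `η x`: the flow is
`|ξ x⟩ - |η x⟩`, and the potential function is `|ξ x⟩ + |η x⟩`. -/
def databaseUpdate (ξ η : 𝒟 → B) (O : ReflectionOracle 𝒟 ℳ) : HyperedgeProblem 𝒟 B ℳ where
  flow x := EuclideanSpace.single (ξ x) 1 - EuclideanSpace.single (η x) 1
  potential x := EuclideanSpace.single (ξ x) 1 + EuclideanSpace.single (η x) 1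
  oracle := O
  potential_const := by
    intro x u v hu hv
    by_cases h : ξ x = η x
    · simp [h] at hu
    · simp only [PiLp.sub_apply, PiLp.add_apply, PiLp.single_apply] at hu hv ⊢
      split_ifs at hu hv ⊢ <;> simp_all
  sum_flow := by
    intro x
    simp [Finset.sum_sub_distrib]

end HyperedgeProblem

/-- A span program on `𝒟` in the space `H`: an input-dependent subspace for each input, an
input-independent subspace, and an initial vector that is orthogonal to the latter. -/
structure SpanProgram (𝒟 H : Type*) [NormedAddCommGroup H] [InnerProductSpace ℂ H] where
  inputSpace : 𝒟 → Submodule ℂ H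
  space : Submodule ℂ H
  initial : H
  initial_mem : initial ∈ spaceᗮ

namespace SpanProgram

variable {𝒟 H : Type*} [NormedAddCommGroup H] [InnerProductSpace ℂ H] (P : SpanProgram 𝒟 H)

/-- The positive witnesses for `x`. -/
def posWitnesses (x : 𝒟) : Set H := {w | w ∈ P.inputSpace x ∧ w - P.initial ∈ P.space}

/-- The negative witnesses for `x`. -/
def negWitnesses (x : 𝒟) : Set H :=
  {w | w ∈ (P.inputSpace x)ᗮ ∧ w ∈ P.spaceᗮ ∧ inner ℂ P.initial w = 1}

/-- `x` is a positive input. Equivalently, the initial vector is in `space + inputSpace x`. -/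
def IsPositive (x : 𝒟) : Prop := (P.posWitnesses x).Nonempty

def IsNegative (x : 𝒟) : Prop := (P.negWitnesses x).Nonempty

/-- The minimal size of a positive witness for `x`. It is `0` if `x` is not a positive input. -/
def posSize (x : 𝒟) : ℝ := sInf ((fun w => ‖w‖ ^ 2) '' P.posWitnesses x)

/-- The minimal size of a negative witness for `x`. It is `0` if `x` is not a negative input. -/
def negSize (x : 𝒟) : ℝ := sInf ((fun w => ‖w‖ ^ 2) '' P.negWitnesses x)

/-- The complexity `√(W₊ W₋)`, where `W₊` and `W₋` are the maxima of the minimal witness sizes over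
the positive and the negative inputs. -/
def complexity : ℝ :=
  √((⨆ x : {x // P.IsPositive x}, P.posSize x) * ⨆ x : {x // P.IsNegative x}, P.negSize x)

/-- `P` computes the function that is true exactly on the inputs that satisfy `f`. -/
def Computes (f : 𝒟 → Prop) : Prop := ∀ x, (f x → P.IsPositive x) ∧ (¬ f x → P.IsNegative x)

end SpanProgram

/-- An instance of quantum walk search on the graph `G` with resistances `r`. The setup routine of
`v`, the update routine of `e` and the checking routine of `(v, D)` use the oracle spaces `MS v` and
`MU e` with workspaces `WS v` and `WU e`, and the space `HC v D`, respectively. -/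
structure QuantumWalkSearch (V E 𝒟 𝒮 : Type*) [Fintype V] [Fintype E] [Fintype 𝒮]
    (MS WS : V → Type*) (MU WU : E → Type*) (HC : V → 𝒮 → Type*)
    [∀ v, NormedAddCommGroup (MS v)] [∀ v, InnerProductSpace ℂ (MS v)]
    [∀ v, FiniteDimensional ℂ (MS v)]
    [∀ v, NormedAddCommGroup (WS v)] [∀ v, InnerProductSpace ℂ (WS v)]
    [∀ e, NormedAddCommGroup (MU e)] [∀ e, InnerProductSpace ℂ (MU e)]
    [∀ e, FiniteDimensional ℂ (MU e)]
    [∀ e, NormedAddCommGroup (WU e)] [∀ e, InnerProductSpace ℂ (WU e)]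
    [∀ v D, NormedAddCommGroup (HC v D)] [∀ v D, InnerProductSpace ℂ (HC v D)] where
  G : MultiGraph V E
  connected : G.IsConnected
  r : E → ℝ
  r_pos : ∀ e, 0 < r e
  sum_inv_r : ∑ e, (r e)⁻¹ = 1 / 2
  /-- The set of marked vertices. -/
  marked : 𝒟 → Set V
  /-- The database entry at `v` for the input `x`. -/
  entry : V → 𝒟 → 𝒮
  setupOracle : ∀ v, ReflectionOracle 𝒟 (MS v)
  updateOracle : ∀ e, ReflectionOracle 𝒟 (MU e)
  /-- The setup routine of `v` computes `entry v x`. Its vertices are a source, which is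
  `none : Option 𝒮`, and one vertex `some D` for each state `D` of the database at `v`. -/
  setup : ∀ v, (HyperedgeProblem.databaseUpdate (fun _ => none) (fun x => some (entry v x))
    (setupOracle v)).toStateReflection.Solution (WS v)
  /-- The update routine of an edge between `v` and `w` updates `entry v x` to `entry w x`. Its
  vertices are the pairs `(u, D)` with `u ∈ {v, w}`, as a subset of `V × 𝒮`. -/
  update : ∀ e, (HyperedgeProblem.databaseUpdate (fun x => (G.tail e, entry (G.tail e) x))
    (fun x => (G.head e, entry (G.head e) x)) (updateOracle e)).toStateReflection.Solution (WU e)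
  /-- The checking routines. -/
  check : ∀ v D, SpanProgram 𝒟 (HC v D)
  /-- If `D` is the database entry at `v`, then the checking routine of `(v, D)` decides whether
  `v` is marked. For other `D`, it may err. -/
  check_correct : ∀ v D x, D = entry v x →
    (v ∈ marked x → (check v D).IsPositive x) ∧ (v ∉ marked x → (check v D).IsNegative x)

namespace QuantumWalkSearch

variable {V E 𝒟 𝒮 : Type*} [Fintype V] [Fintype E] [Fintype 𝒮]
  {MS WS : V → Type*} {MU WU : E → Type*} {HC : V → 𝒮 → Type*}
  [∀ v, NormedAddCommGroup (MS v)] [∀ v, InnerProductSpace ℂ (MS v)]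
  [∀ v, FiniteDimensional ℂ (MS v)]
  [∀ v, NormedAddCommGroup (WS v)] [∀ v, InnerProductSpace ℂ (WS v)]
  [∀ e, NormedAddCommGroup (MU e)] [∀ e, InnerProductSpace ℂ (MU e)]
  [∀ e, FiniteDimensional ℂ (MU e)]
  [∀ e, NormedAddCommGroup (WU e)] [∀ e, InnerProductSpace ℂ (WU e)]
  [∀ v D, NormedAddCommGroup (HC v D)] [∀ v D, InnerProductSpace ℂ (HC v D)]
  (Q : QuantumWalkSearch V E 𝒟 𝒮 MS WS MU WU HC)

/-- The orthogonal direct sum of the spaces of all the setup, update and checking routines. -/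
abbrev Space (_Q : QuantumWalkSearch V E 𝒟 𝒮 MS WS MU WU HC) : Type _ :=
  WithLp 2 (PiLp 2 (fun v => MS v ⊗[ℂ] WS v) ×
    WithLp 2 (PiLp 2 (fun e => MU e ⊗[ℂ] WU e) × PiLp 2 (fun p : V × 𝒮 => HC p.1 p.2)))

/-- The `+1`-eigenspace of the direct sum of the oracles of all the routines, where the oracle of a
checking routine is the reflection through its input-dependent subspace. -/
def inputSpace (x : 𝒟) : Submodule ℂ Q.Space where
  carrier := {h |
    (∀ v, h.fst v ∈ (HyperedgeProblem.databaseUpdate (fun _ => none)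
      (fun y => some (Q.entry v y)) (Q.setupOracle v)).toStateReflection.plusSpace (WS v) x) ∧
    (∀ e, h.snd.fst e ∈ (HyperedgeProblem.databaseUpdate
      (fun y => (Q.G.tail e, Q.entry (Q.G.tail e) y))
      (fun y => (Q.G.head e, Q.entry (Q.G.head e) y))
      (Q.updateOracle e)).toStateReflection.plusSpace (WU e) x) ∧
    (∀ p : V × 𝒮, h.snd.snd p ∈ (Q.check p.1 p.2).inputSpace x)}
  add_mem' := fun ha hb => ⟨fun v => add_mem (ha.1 v) (hb.1 v),
    fun e => add_mem (ha.2.1 e) (hb.2.1 e), fun p => add_mem (ha.2.2 p) (hb.2.2 p)⟩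
  zero_mem' := ⟨fun _ => zero_mem _, fun _ => zero_mem _, fun _ => zero_mem _⟩
  smul_mem' := fun c _ ha => ⟨fun v => Submodule.smul_mem _ c (ha.1 v),
    fun e => Submodule.smul_mem _ c (ha.2.1 e), fun p => Submodule.smul_mem _ c (ha.2.2 p)⟩

/-- The transition matrix of the random walk on `G` with resistances `r`. -/
def walk : Matrix V V ℝ := Q.G.walkMatrix Q.r

/-- The stationary distribution of the random walk on `G` with resistances `r`. -/
def stationary : V → ℝ := Q.G.stationary Q.r

/-- The geometric mean of the maximal positive and the maximal negative witness size of the setup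
routines. -/
def setupCost : ℝ :=
  √((⨆ v, ⨆ x, (Q.setup v).posSize x) * ⨆ v, ⨆ x, (Q.setup v).negSize x)

/-- The geometric mean of the maximal positive and the maximal negative witness size of the update
routines. -/
def updateCost : ℝ :=
  √((⨆ e, ⨆ x, (Q.update e).posSize x) * ⨆ e, ⨆ x, (Q.update e).negSize x)

/-- The geometric mean of the maximal positive and the maximal negative witness size of the checking
routines, when these are used with the correct database entry. -/
def checkCost : ℝ :=
  √((⨆ v, ⨆ x, (Q.check v (Q.entry v x)).posSize x) *
    ⨆ v, ⨆ x, (Q.check v (Q.entry v x)).negSize x)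

end QuantumWalkSearch

end

/-!
The span program is built from its witnesses. By duality (`SpanProgram.exists_of_witnesses`), a
span program that accepts the inputs `x` with `f x` and rejects the other ones amounts to vectors
`p x` in the input spaces and `n y` in their orthogonal complements with `⟨p x, n y⟩ = 1` whenever
`f x` and `¬ f y`, and its complexity is bounded by the norms of these vectors.

The witnesses of all routines are available for this purpose. Let `m v` be `1` if `x` and `y` have
the same database entry at `v`, and `0` otherwise. The adversary constraints show that the
witnesses of the setup routine of `v` have inner product `1 - m v`, those of the update routine of
`e` have inner product `m (tail e) - m (head e)`, and those of the checking routines of `v`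
contribute `m v` if `v` is marked for `x` but not for `y`. Hence, if `g` is a flow on `G` from `σ`
to a distribution `ν` on the marked vertices of `x`, then the combination with coefficients `σ`,
`g` and `ν` has inner product `∑ σ (1 - m) + ∑ m (σ - ν) + ∑ ν m = 1`
(`QuantumWalkSearch.inner_combine_eq_one`). The coefficients are split between `p x` and `n y`
with weights `σ v` for the setup routines, `1 / r e` for the update routines and `σ v + π v` for
the checking routines. The weights have total `1`, `1 / 2` and `2`, which bounds `n y`, whereas
`p x` is bounded in terms of the energy of `g` and `∑ ν ^ 2 / (σ + π)`.

It remains to find such a flow, given a flow of energy `R` from `σ` to the marked vertices in the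
graph of `P ^ t`. By Cauchy-Schwarz, the net-flow `δ = σ - ν` satisfies
`⟨ψ, δ⟩² ≤ R ⟨ψ, (1 - P ^ t) ψ⟩` for every potential `ψ`. Since `P` is self-adjoint for the
stationary inner product and `-1 ≤ P ≤ 1`, one has `1 - P ^ t ≤ t (1 - P)`
(`IsReversibleWalk.dirichletForm_pow_le`), so the electrical flow on `G` with net-flow `δ` has energy `O(t R)`
(`MultiGraph.exists_flow_of_forall_potential`). With `ψ = δ / π` and `1 - P ^ t ≤ 2`, the same
inequality gives `∑ δ ^ 2 / π ≤ 2 R`, and so `∑ ν ^ 2 / (σ + π) = O(1 + R)`.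

Scaling the three kinds of routines separately balances positive and negative witness sizes.
Witnesses and flows need only be optimal up to an arbitrarily small error: unless the answer is
the same for all inputs, when the complexity is `0`, the claimed bound is at least `1`
(`QuantumWalkSearch.one_le_setupCost_or_one_le_checkCost`).
-/

/-! ### Span programs from families of witnesses -/

theorem bddBelow_sq_norm {H : Type*} [NormedAddCommGroup H] (S : Set H) :
    BddBelow ((fun w : H => ‖w‖ ^ 2) '' S) :=
  ⟨0, by rintro _ ⟨w, -, rfl⟩; positivity⟩

namespace SpanProgram

variable {𝒟 H : Type*} [NormedAddCommGroup H] [InnerProductSpace ℂ H]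

/-- A positive and a negative witness of a span program, even for different inputs, have inner
product `1`. -/
theorem inner_eq_one {P : SpanProgram 𝒟 H} {x y : 𝒟} {w w' : H}
    (hw : w ∈ P.posWitnesses x) (hw' : w' ∈ P.negWitnesses y) : inner ℂ w w' = 1 := by
  have h := hw'.2.1 _ hw.2
  rw [inner_sub_left, sub_eq_zero] at h
  rw [h, hw'.2.2]

theorem not_isNegative_of_isPositive {P : SpanProgram 𝒟 H} {x : 𝒟} (h : P.IsPositive x) :
    ¬ P.IsNegative x := by
  rintro ⟨w', hw'⟩
  obtain ⟨w, hw⟩ := h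
  have h1 := inner_eq_one hw hw'
  rw [hw'.1 w hw.1] at h1
  exact zero_ne_one h1

theorem posSize_le {P : SpanProgram 𝒟 H} {x : 𝒟} {w : H} (hw : w ∈ P.posWitnesses x) :
    P.posSize x ≤ ‖w‖ ^ 2 :=
  csInf_le (bddBelow_sq_norm _) ⟨w, hw, rfl⟩

theorem negSize_le {P : SpanProgram 𝒟 H} {x : 𝒟} {w : H} (hw : w ∈ P.negWitnesses x) :
    P.negSize x ≤ ‖w‖ ^ 2 :=
  csInf_le (bddBelow_sq_norm _) ⟨w, hw, rfl⟩

theorem posSize_nonneg (P : SpanProgram 𝒟 H) (x : 𝒟) : 0 ≤ P.posSize x :=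
  Real.sInf_nonneg (by rintro _ ⟨w, -, rfl⟩; positivity)

theorem negSize_nonneg (P : SpanProgram 𝒟 H) (x : 𝒟) : 0 ≤ P.negSize x :=
  Real.sInf_nonneg (by rintro _ ⟨w, -, rfl⟩; positivity)

theorem exists_posWitness_lt {P : SpanProgram 𝒟 H} {x : 𝒟} (h : P.IsPositive x) {a : ℝ}
    (ha : P.posSize x < a) : ∃ w ∈ P.posWitnesses x, ‖w‖ ^ 2 < a := by
  obtain ⟨_, ⟨w, hw, rfl⟩, hlt⟩ := exists_lt_of_csInf_lt (h.image _) ha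
  exact ⟨w, hw, hlt⟩

theorem exists_negWitness_lt {P : SpanProgram 𝒟 H} {x : 𝒟} (h : P.IsNegative x) {a : ℝ}
    (ha : P.negSize x < a) : ∃ w ∈ P.negWitnesses x, ‖w‖ ^ 2 < a := by
  obtain ⟨_, ⟨w, hw, rfl⟩, hlt⟩ := exists_lt_of_csInf_lt (h.image _) ha
  exact ⟨w, hw, hlt⟩

theorem one_le_posSize_mul_negSize {P : SpanProgram 𝒟 H} {x y : 𝒟} (hx : P.IsPositive x)
    (hy : P.IsNegative y) : 1 ≤ P.posSize x * P.negSize y := by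
  have key : ∀ w ∈ P.posWitnesses x, ∀ w' ∈ P.negWitnesses y, 1 ≤ ‖w‖ ^ 2 * ‖w'‖ ^ 2 := by
    intro w hw w' hw'
    have h := norm_inner_le_norm (𝕜 := ℂ) w w'
    rw [inner_eq_one hw hw', norm_one] at h
    rw [← mul_pow]
    exact one_le_pow₀ h
  refine le_of_forall_pos_lt_add fun ε hε => ?_
  -- near-optimal witnesses suffice, since multiplication is continuous
  have hcont : Filter.Tendsto (fun η : ℝ => (P.posSize x + η) * (P.negSize y + η))
      (nhdsWithin 0 (Set.Ioi 0)) (nhds (P.posSize x * P.negSize y)) := by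
    have : Continuous fun η : ℝ => (P.posSize x + η) * (P.negSize y + η) := by fun_prop
    simpa using (this.tendsto 0).mono_left nhdsWithin_le_nhds
  obtain ⟨η, hlt, hη⟩ := ((hcont.eventually_lt_const
    (lt_add_of_pos_right _ hε)).and self_mem_nhdsWithin).exists
  obtain ⟨w, hw, hw1⟩ := exists_posWitness_lt hx (lt_add_of_pos_right (P.posSize x) hη)
  obtain ⟨w', hw', hw1'⟩ := exists_negWitness_lt hy (lt_add_of_pos_right (P.negSize y) hη)
  refine ((key w hw w' hw').trans ?_).trans_lt hlt
  exact mul_le_mul hw1.le hw1'.le (by positivity) ((sq_nonneg _).trans hw1.le)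

theorem Computes.isPositive_iff {P : SpanProgram 𝒟 H} {f : 𝒟 → Prop} (h : P.Computes f) {x : 𝒟} :
    P.IsPositive x ↔ f x :=
  ⟨fun hx => by_contra fun hf => not_isNegative_of_isPositive hx ((h x).2 hf), (h x).1⟩

theorem Computes.isNegative_iff {P : SpanProgram 𝒟 H} {f : 𝒟 → Prop} (h : P.Computes f) {x : 𝒟} :
    P.IsNegative x ↔ ¬ f x :=
  ⟨fun hx hf => not_isNegative_of_isPositive ((h x).1 hf) hx, (h x).2⟩

theorem Computes.complexity_eq_zero_of_forall {P : SpanProgram 𝒟 H} {f : 𝒟 → Prop}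
    (h : P.Computes f) (hf : ∀ x, f x) : P.complexity = 0 := by
  have : IsEmpty {x // P.IsNegative x} := ⟨fun x => h.isNegative_iff.1 x.2 (hf x)⟩
  simp [complexity, Real.iSup_of_isEmpty]

theorem Computes.complexity_eq_zero_of_forall_not {P : SpanProgram 𝒟 H} {f : 𝒟 → Prop}
    (h : P.Computes f) (hf : ∀ x, ¬ f x) : P.complexity = 0 := by
  have : IsEmpty {x // P.IsPositive x} := ⟨fun x => hf x (h.isPositive_iff.1 x.2)⟩
  simp [complexity, Real.iSup_of_isEmpty]

/-- Duality for span programs: a span program that computes `f` amounts to vectors `p x` in the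
input spaces and `n y` in their orthogonal complements that have inner product `1`. The vector `p₀`
only matters if `f` is false everywhere, when it supplies the initial vector. -/
theorem exists_of_witnesses [Finite 𝒟] (S : 𝒟 → Submodule ℂ H) (f : 𝒟 → Prop) (p n : 𝒟 → H)
    (p₀ : H) (hp : ∀ x, f x → p x ∈ S x) (hn : ∀ y, ¬ f y → n y ∈ (S y)ᗮ)
    (hpn : ∀ x y, f x → ¬ f y → inner ℂ (p x) (n y) = 1)
    (hp₀ : ∀ y, ¬ f y → inner ℂ p₀ (n y) = 1) :
    ∃ P : SpanProgram 𝒟 H, P.inputSpace = S ∧ P.Computes f ∧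
      ∀ W : ℝ, 0 ≤ W → (∀ x, f x → ‖p x‖ ^ 2 ≤ W) → (∀ y, ¬ f y → ‖n y‖ ^ 2 ≤ W) →
        P.complexity ≤ W := by
  let K : Submodule ℂ H := Submodule.span ℂ (Set.range fun x : {x // f x} => p x - p₀)
  have : FiniteDimensional ℂ K := FiniteDimensional.span_of_finite ℂ (Set.finite_range _)
  have hnK : ∀ y, ¬ f y → n y ∈ Kᗮ := by
    intro y hy
    rw [Submodule.mem_orthogonal]
    intro u hu
    induction hu using Submodule.span_induction with
    | mem u hu =>
      obtain ⟨x, rfl⟩ := hu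
      simp [inner_sub_left, hpn x y x.2 hy, hp₀ y hy]
    | zero => simp
    | add u v _ _ hu hv => simp [inner_add_left, hu, hv]
    | smul c u _ hu => simp [inner_smul_left, hu]
  let P : SpanProgram 𝒟 H :=
    { inputSpace := S
      space := K
      initial := p₀ - K.starProjection p₀
      initial_mem := K.sub_starProjection_mem_orthogonal p₀ }
  have hpos : ∀ x, f x → p x ∈ P.posWitnesses x := by
    intro x hx
    refine ⟨hp x hx, ?_⟩
    have h : p x - (p₀ - K.starProjection p₀) = (p x - p₀) + K.starProjection p₀ := by abel
    change p x - (p₀ - K.starProjection p₀) ∈ K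
    rw [h]
    exact add_mem (Submodule.subset_span ⟨⟨x, hx⟩, rfl⟩) (K.starProjection_apply_mem p₀)
  have hneg : ∀ y, ¬ f y → n y ∈ P.negWitnesses y := by
    intro y hy
    refine ⟨hn y hy, hnK y hy, ?_⟩
    change inner ℂ (p₀ - K.starProjection p₀) (n y) = 1
    rw [inner_sub_left, hp₀ y hy, hnK y hy _ (K.starProjection_apply_mem p₀), sub_zero]
  have hcomp : P.Computes f := fun x => ⟨fun h => ⟨_, hpos x h⟩, fun h => ⟨_, hneg x h⟩⟩
  refine ⟨P, rfl, hcomp, fun W hW h1 h2 => ?_⟩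
  have hpos' : (⨆ x : {x // P.IsPositive x}, P.posSize x) ≤ W :=
    Real.iSup_le (fun x => (posSize_le (hpos x (hcomp.isPositive_iff.1 x.2))).trans
      (h1 x (hcomp.isPositive_iff.1 x.2))) hW
  have hneg' : (⨆ x : {x // P.IsNegative x}, P.negSize x) ≤ W :=
    Real.iSup_le (fun x => (negSize_le (hneg x (hcomp.isNegative_iff.1 x.2))).trans
      (h2 x (hcomp.isNegative_iff.1 x.2))) hW
  have hneg₀ : 0 ≤ ⨆ x : {x // P.IsNegative x}, P.negSize x :=
    Real.iSup_nonneg fun x => P.negSize_nonneg x.1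
  exact Real.sqrt_le_iff.2 ⟨hW, (mul_le_mul hpos' hneg' hneg₀ hW).trans_eq (sq W).symm⟩

end SpanProgram

/-! ### Solutions of state-reflection problems -/

theorem LinearMap.inner_rTensor_left {ℳ 𝒲 : Type*}
    [NormedAddCommGroup ℳ] [InnerProductSpace ℂ ℳ] [FiniteDimensional ℂ ℳ]
    [NormedAddCommGroup 𝒲] [InnerProductSpace ℂ 𝒲] (A : ℳ →ₗ[ℂ] ℳ) (x y : ℳ ⊗[ℂ] 𝒲) :
    inner ℂ (LinearMap.rTensor 𝒲 A x) y = inner ℂ x (LinearMap.rTensor 𝒲 (adjoint A) y) := by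
  induction x with
  | zero => simp
  | add x x' hx hx' => simp [inner_add_left, hx, hx']
  | tmul m u =>
    induction y with
    | zero => simp
    | add y y' hy hy' => simp only [map_add, inner_add_right, hy, hy']
    | tmul m' u' => simp [LinearMap.adjoint_inner_right]

namespace StateReflection

variable {𝒟 𝒱 ℳ 𝒲 : Type*}
  [NormedAddCommGroup 𝒱] [InnerProductSpace ℂ 𝒱]
  [NormedAddCommGroup ℳ] [InnerProductSpace ℂ ℳ] [FiniteDimensional ℂ ℳ]
  [NormedAddCommGroup 𝒲] [InnerProductSpace ℂ 𝒲]

theorem adjoint_oracle (R : StateReflection 𝒟 𝒱 ℳ) (x : 𝒟) :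
    LinearMap.adjoint (R.oracle x) = R.oracle x := by
  calc LinearMap.adjoint (R.oracle x)
      = LinearMap.adjoint (R.oracle x) * R.oracle x * R.oracle x := by
        rw [mul_assoc, R.oracle_sq, mul_one]
    _ = R.oracle x := by rw [R.oracle_unitary, one_mul]

/-- Since the witnesses are eigenvectors of the oracles, the adversary constraints between a
positive and a negative instance determine the inner product of the two witnesses. -/
theorem Solution.inner_posWitness_negWitness {R : StateReflection 𝒟 𝒱 ℳ} (w : R.Solution 𝒲)
    (x y : 𝒟) :
    inner ℂ (w.posWitness x) (w.negWitness y) = inner ℂ (R.pos x) (R.neg y) := by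
  have h := w.feasible (Sum.inl x) (Sum.inr y)
  simp only [toStateConversion, Sum.elim_inl, Sum.elim_inr, Pi.neg_apply, inner_neg_right,
    LinearMap.rTensor_sub, LinearMap.rTensor_mul, LinearMap.sub_apply, Module.End.mul_apply,
    w.oracle_negWitness, map_neg, sub_neg_eq_add, inner_add_right,
    ← LinearMap.inner_rTensor_left, w.oracle_posWitness] at h
  have h1 : LinearMap.rTensor 𝒲 (1 : Module.End ℂ ℳ) (w.negWitness y) = w.negWitness y :=
    LinearMap.congr_fun (LinearMap.rTensor_id 𝒲 ℳ) _
  rw [h1] at h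
  linear_combination -(1 / 2 : ℂ) * h

theorem Solution.posWitness_mem {R : StateReflection 𝒟 𝒱 ℳ} (w : R.Solution 𝒲) (x : 𝒟) :
    w.posWitness x ∈ R.plusSpace 𝒲 x := by
  rw [plusSpace, Module.End.mem_eigenspace_iff, one_smul]
  exact w.oracle_posWitness x

theorem Solution.inner_negWitness_eq_zero {R : StateReflection 𝒟 𝒱 ℳ} (w : R.Solution 𝒲) {x : 𝒟}
    {h : ℳ ⊗[ℂ] 𝒲} (hh : h ∈ R.plusSpace 𝒲 x) : inner ℂ h (w.negWitness x) = 0 := by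
  rw [plusSpace, Module.End.mem_eigenspace_iff, one_smul] at hh
  have h1 := LinearMap.inner_rTensor_left (R.oracle x) h (w.negWitness x)
  rw [hh, R.adjoint_oracle, w.oracle_negWitness, inner_neg_right] at h1
  linear_combination (1 / 2 : ℂ) * h1

theorem Solution.posSize_nonneg {R : StateReflection 𝒟 𝒱 ℳ} (w : R.Solution 𝒲) (x : 𝒟) :
    0 ≤ w.posSize x := by
  unfold posSize; positivity

theorem Solution.negSize_nonneg {R : StateReflection 𝒟 𝒱 ℳ} (w : R.Solution 𝒲) (x : 𝒟) :
    0 ≤ w.negSize x := by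
  unfold negSize; positivity

end StateReflection

namespace HyperedgeProblem

variable {𝒟 B ℳ : Type*} [Fintype B]
  [NormedAddCommGroup ℳ] [InnerProductSpace ℂ ℳ] [FiniteDimensional ℂ ℳ]

open Classical in
theorem inner_flow_potential_databaseUpdate (ξ η : 𝒟 → B) (O : ReflectionOracle 𝒟 ℳ) (x y : 𝒟) :
    inner ℂ ((databaseUpdate ξ η O).toStateReflection.pos x)
        ((databaseUpdate ξ η O).toStateReflection.neg y) =
      (if ξ x = ξ y then 1 else 0) + (if ξ x = η y then 1 else 0)
        - (if η x = ξ y then 1 else 0) - (if η x = η y then 1 else 0) := by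
  simp only [toStateReflection, databaseUpdate, inner_sub_left, inner_add_right,
    EuclideanSpace.inner_single_left, PiLp.single_apply, map_one, one_mul]
  ring

end HyperedgeProblem

/-! ### Dirichlet forms of reversible Markov processes -/

/-- `P` is the transition matrix of a Markov process that is reversible with respect to the
positive weights `π`, which need not be normalised. -/
structure IsReversibleWalk {V : Type*} [Fintype V] (P : Matrix V V ℝ) (π : V → ℝ) : Prop where
  weight_pos : ∀ v, 0 < π v
  nonneg : ∀ v w, 0 ≤ P v w
  row_sum : ∀ v, ∑ w, P v w = 1
  balance : ∀ v w, π v * P v w = π w * P w v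

/-- The Dirichlet form `⟨a, (1 - P) b⟩`, in the inner product with weights `π`. -/
def dirichletForm {V : Type*} [Fintype V] (P : Matrix V V ℝ) (π : V → ℝ) (a b : V → ℝ) : ℝ :=
  ∑ v, π v * (a v * (b v - (P.mulVec b) v))

namespace IsReversibleWalk

variable {V : Type*} [Fintype V] {P : Matrix V V ℝ} {π : V → ℝ}

theorem one [DecidableEq V] (hπ : ∀ v, 0 < π v) : IsReversibleWalk (1 : Matrix V V ℝ) π where
  weight_pos := hπ
  nonneg v w := by rw [Matrix.one_apply]; split_ifs <;> norm_num
  row_sum v := by simp [Matrix.one_apply]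
  balance v w := by
    by_cases h : v = w
    · rw [h]
    · simp [h, Ne.symm h]

theorem pow [DecidableEq V] (h : IsReversibleWalk P π) (k : ℕ) : IsReversibleWalk (P ^ k) π := by
  induction k with
  | zero => rw [pow_zero]; exact one h.weight_pos
  | succ k ih =>
    refine ⟨h.weight_pos, fun v w => ?_, fun v => ?_, fun v w => ?_⟩
    · rw [pow_succ, Matrix.mul_apply]
      exact Finset.sum_nonneg fun u _ => mul_nonneg (ih.nonneg v u) (h.nonneg u w)
    · simp_rw [pow_succ, Matrix.mul_apply]
      rw [Finset.sum_comm]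
      simp_rw [← Finset.mul_sum, h.row_sum, mul_one]
      exact ih.row_sum v
    · conv_lhs => rw [pow_succ, Matrix.mul_apply]
      conv_rhs => rw [pow_succ', Matrix.mul_apply]
      rw [Finset.mul_sum, Finset.mul_sum]
      refine Finset.sum_congr rfl fun u _ => ?_
      rw [← mul_assoc, ih.balance, ← mul_assoc, ← h.balance u w]
      ring

theorem sum_mul_mulVec (h : IsReversibleWalk P π) (a b : V → ℝ) :
    ∑ v, π v * (a v * (P.mulVec b) v) = ∑ v, π v * ((P.mulVec a) v * b v) := by
  simp only [Matrix.mulVec, dotProduct, Finset.mul_sum, Finset.sum_mul]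
  rw [Finset.sum_comm]
  refine Finset.sum_congr rfl fun w _ => Finset.sum_congr rfl fun v _ => ?_
  linear_combination a v * b w * h.balance v w

theorem dirichletForm_comm (h : IsReversibleWalk P π) (a b : V → ℝ) :
    dirichletForm P π a b = dirichletForm P π b a := by
  simp only [dirichletForm, mul_sub, Finset.sum_sub_distrib]
  rw [h.sum_mul_mulVec a b]
  congr 1 <;> exact Finset.sum_congr rfl fun v _ => by ring

/-- For `s = 1` and `s = -1`, this shows that `1 - P` and `1 + P` are positive semidefinite. -/
theorem sum_mul_sub_mulVec (h : IsReversibleWalk P π) (a : V → ℝ) {s : ℝ} (hs : s ^ 2 = 1) :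
    ∑ v, π v * (a v * (a v - s * (P.mulVec a) v)) =
      (∑ v, ∑ w, π v * P v w * (a v - s * a w) ^ 2) / 2 := by
  have h1 : ∑ v, ∑ w, π v * P v w * a v ^ 2 = ∑ v, π v * a v ^ 2 := by
    refine Finset.sum_congr rfl fun v _ => ?_
    rw [← Finset.sum_mul, ← Finset.mul_sum, h.row_sum, mul_one]
  have h2 : ∑ v, ∑ w, π v * P v w * a w ^ 2 = ∑ v, π v * a v ^ 2 := by
    rw [Finset.sum_comm, ← h1]
    exact Finset.sum_congr rfl fun w _ => Finset.sum_congr rfl fun v _ => by rw [h.balance]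
  have h3 : ∑ v, ∑ w, π v * P v w * (a v * a w) = ∑ v, π v * (a v * (P.mulVec a) v) := by
    simp only [Matrix.mulVec, dotProduct, Finset.mul_sum]
    exact Finset.sum_congr rfl fun v _ => Finset.sum_congr rfl fun w _ => by ring
  have h4 : ∑ v, ∑ w, π v * P v w * (a v - s * a w) ^ 2 =
      ∑ v, ∑ w, π v * P v w * a v ^ 2 + ∑ v, ∑ w, π v * P v w * a w ^ 2
        - 2 * s * ∑ v, ∑ w, π v * P v w * (a v * a w) := by
    simp only [Finset.mul_sum, ← Finset.sum_add_distrib, ← Finset.sum_sub_distrib]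
    refine Finset.sum_congr rfl fun v _ => Finset.sum_congr rfl fun w _ => ?_
    linear_combination π v * P v w * a w ^ 2 * hs
  have h5 : ∑ v, π v * (a v * (a v - s * (P.mulVec a) v)) =
      ∑ v, π v * a v ^ 2 - s * ∑ v, π v * (a v * (P.mulVec a) v) := by
    simp only [Finset.mul_sum, ← Finset.sum_sub_distrib]
    exact Finset.sum_congr rfl fun v _ => by ring
  rw [h4, h1, h2, h3, h5]
  ring

theorem dirichletForm_self (h : IsReversibleWalk P π) (a : V → ℝ) :
    dirichletForm P π a a = (∑ v, ∑ w, π v * P v w * (a v - a w) ^ 2) / 2 := by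
  simpa [dirichletForm] using h.sum_mul_sub_mulVec a (s := 1) (by norm_num)

theorem sum_mul_sub_mulVec_nonneg (h : IsReversibleWalk P π) (a : V → ℝ) {s : ℝ}
    (hs : s ^ 2 = 1) : 0 ≤ ∑ v, π v * (a v * (a v - s * (P.mulVec a) v)) := by
  rw [h.sum_mul_sub_mulVec a hs]
  exact div_nonneg (Finset.sum_nonneg fun v _ => Finset.sum_nonneg fun w _ =>
    mul_nonneg (mul_nonneg (h.weight_pos v).le (h.nonneg v w)) (sq_nonneg _)) zero_le_two

theorem dirichletForm_self_nonneg (h : IsReversibleWalk P π) (a : V → ℝ) :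
    0 ≤ dirichletForm P π a a := by
  simpa [dirichletForm] using h.sum_mul_sub_mulVec_nonneg a (s := 1) (by norm_num)

theorem dirichletForm_self_le (h : IsReversibleWalk P π) (a : V → ℝ) :
    dirichletForm P π a a ≤ 2 * ∑ v, π v * a v ^ 2 := by
  have h1 := h.sum_mul_sub_mulVec_nonneg a (s := -1) (by norm_num)
  have h2 : 2 * ∑ v, π v * a v ^ 2 = dirichletForm P π a a
      + ∑ v, π v * (a v * (a v - -1 * (P.mulVec a) v)) := by
    simp only [dirichletForm, Finset.mul_sum, ← Finset.sum_add_distrib]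
    exact Finset.sum_congr rfl fun v _ => by ring
  linarith

/-- `P (1 - P) P ≤ 1 - P`, because the difference `(1 - P)² (1 + P)` is positive semidefinite. -/
theorem dirichletForm_mulVec_le (h : IsReversibleWalk P π) (a : V → ℝ) :
    dirichletForm P π (P.mulVec a) (P.mulVec a) ≤ dirichletForm P π a a := by
  have h1 := h.sum_mul_sub_mulVec_nonneg (a - P.mulVec a) (s := -1) (by norm_num)
  have h3 := h.sum_mul_mulVec a (P.mulVec a)
  have key : dirichletForm P π a a - dirichletForm P π (P.mulVec a) (P.mulVec a) =
      ∑ v, π v * ((a - P.mulVec a) v *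
        ((a - P.mulVec a) v - -1 * (P.mulVec (a - P.mulVec a)) v)) := by
    have h5 : ∑ v, π v * ((a - P.mulVec a) v *
        ((a - P.mulVec a) v - -1 * (P.mulVec (a - P.mulVec a)) v)) =
        dirichletForm P π a a - dirichletForm P π (P.mulVec a) (P.mulVec a)
          + (∑ v, π v * ((P.mulVec a) v * (P.mulVec a) v)
            - ∑ v, π v * (a v * (P.mulVec (P.mulVec a)) v)) := by
      simp only [dirichletForm, ← Finset.sum_add_distrib, ← Finset.sum_sub_distrib,
        Matrix.mulVec_sub, Pi.sub_apply]
      exact Finset.sum_congr rfl fun v _ => by ring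
    rw [h5, h3, sub_self, add_zero]
  linarith

theorem dirichletForm_pow_mulVec_le [DecidableEq V] (h : IsReversibleWalk P π) (a : V → ℝ)
    (k : ℕ) : dirichletForm P π ((P ^ k).mulVec a) ((P ^ k).mulVec a) ≤ dirichletForm P π a a := by
  induction k with
  | zero => simp
  | succ k ih =>
    rw [pow_succ', ← Matrix.mulVec_mulVec]
    exact (h.dirichletForm_mulVec_le _).trans ih

theorem dirichletForm_le_half (h : IsReversibleWalk P π) (a b : V → ℝ) :
    dirichletForm P π a b ≤ (dirichletForm P π a a + dirichletForm P π b b) / 2 := by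
  have h1 := h.dirichletForm_self_nonneg (a - b)
  have h2 : dirichletForm P π (a - b) (a - b) = dirichletForm P π a a - dirichletForm P π a b
      - dirichletForm P π b a + dirichletForm P π b b := by
    simp only [dirichletForm, ← Finset.sum_add_distrib, ← Finset.sum_sub_distrib,
      Matrix.mulVec_sub, Pi.sub_apply]
    exact Finset.sum_congr rfl fun v _ => by ring
  rw [h.dirichletForm_comm b a] at h2
  linarith

/-- `1 - P ^ t ≤ t (1 - P)`, by telescoping: each of the `t` terms `P ^ k (1 - P)` is at most
`1 - P`. -/
theorem dirichletForm_pow_le [DecidableEq V] (h : IsReversibleWalk P π) (a : V → ℝ) (t : ℕ) :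
    dirichletForm (P ^ t) π a a ≤ t * dirichletForm P π a a := by
  induction t with
  | zero => simp [dirichletForm]
  | succ t ih =>
    have h1 : dirichletForm (P ^ (t + 1)) π a a =
        dirichletForm (P ^ t) π a a + dirichletForm P π a ((P ^ t).mulVec a) := by
      simp only [dirichletForm, ← Finset.sum_add_distrib, pow_succ' P t, ← Matrix.mulVec_mulVec]
      exact Finset.sum_congr rfl fun v _ => by ring
    have h2 := h.dirichletForm_le_half a ((P ^ t).mulVec a)
    have h3 := h.dirichletForm_pow_mulVec_le a t
    rw [h1]
    push_cast
    linarith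

end IsReversibleWalk

/-! ### Flows and potentials -/

namespace MultiGraph

variable {V E : Type*} [Fintype E] (G : MultiGraph V E)

theorem netFlow_add (f g : E → ℝ) : G.netFlow (f + g) = G.netFlow f + G.netFlow g := by
  ext v
  simp only [netFlow, Pi.add_apply, Finset.sum_add_distrib]
  ring

theorem netFlow_smul (c : ℝ) (f : E → ℝ) : G.netFlow (c • f) = c • G.netFlow f := by
  ext v
  simp only [netFlow, Pi.smul_apply, smul_eq_mul, ← Finset.mul_sum, mul_sub]

variable [Fintype V]

theorem sum_mul_netFlow (f : E → ℝ) (ψ : V → ℝ) :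
    ∑ v, ψ v * G.netFlow f v = ∑ e, f e * (ψ (G.tail e) - ψ (G.head e)) := by
  classical
  have aux : ∀ p : E → V, ∑ v, ψ v * ∑ e with p e = v, f e = ∑ e, f e * ψ (p e) := by
    intro p
    simp_rw [Finset.mul_sum, Finset.sum_filter]
    rw [Finset.sum_comm]
    refine Finset.sum_congr rfl fun e _ => ?_
    simp [mul_comm]
  simp only [netFlow, mul_sub, Finset.sum_sub_distrib]
  convert congrArg₂ (· - ·) (aux G.tail) (aux G.head)

/-- The Laplacian of `G` with resistances `r`: it maps a potential to the net-flow of the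
corresponding electrical flow. -/
noncomputable def laplacian (r : E → ℝ) : EuclideanSpace ℝ V →ₗ[ℝ] EuclideanSpace ℝ V where
  toFun φ := WithLp.toLp 2 (G.netFlow fun e => (φ (G.tail e) - φ (G.head e)) / r e)
  map_add' φ ψ := by
    refine Eq.trans ?_ (congrArg (WithLp.toLp 2) (G.netFlow_add _ _))
    congr 2
    ext e
    simp only [PiLp.add_apply, Pi.add_apply]
    ring
  map_smul' c φ := by
    refine Eq.trans ?_ (congrArg (WithLp.toLp 2) (G.netFlow_smul c _))
    congr 2
    ext e
    simp only [PiLp.smul_apply, Pi.smul_apply, smul_eq_mul]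
    ring

theorem inner_laplacian (r : E → ℝ) (φ ψ : EuclideanSpace ℝ V) :
    inner ℝ ψ (G.laplacian r φ) = ∑ e, (φ (G.tail e) - φ (G.head e)) *
      (ψ (G.tail e) - ψ (G.head e)) / r e := by
  have h : inner ℝ ψ (G.laplacian r φ) =
      ∑ v, ψ v * G.netFlow (fun e => (φ (G.tail e) - φ (G.head e)) / r e) v := by
    rw [PiLp.inner_apply]
    exact Finset.sum_congr rfl fun v _ => mul_comm _ _
  rw [h, sum_mul_netFlow]
  exact Finset.sum_congr rfl fun e _ => by ring

theorem laplacian_isSymmetric (r : E → ℝ) : (G.laplacian r).IsSymmetric := by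
  intro φ ψ
  rw [real_inner_comm, inner_laplacian, inner_laplacian]
  exact Finset.sum_congr rfl fun e _ => by ring

/-- Thomson's principle in dual form: a bound on `⟨ψ, δ⟩²` by the Dirichlet energies of all
potentials `ψ` bounds the energy of the electrical flow with net-flow `δ`. -/
theorem exists_flow_of_forall_potential {r : E → ℝ} (hr : ∀ e, 0 < r e) {δ : V → ℝ} {K : ℝ}
    (h : ∀ ψ : V → ℝ, (∑ v, ψ v * δ v) ^ 2 ≤
      K * ∑ e, (ψ (G.tail e) - ψ (G.head e)) ^ 2 / r e) (hK : 0 ≤ K) :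
    ∃ g : E → ℝ, G.netFlow g = δ ∧ ∑ e, g e ^ 2 * r e ≤ K := by
  have hmem : WithLp.toLp 2 δ ∈ LinearMap.range (G.laplacian r) := by
    rw [← Submodule.orthogonal_orthogonal (LinearMap.range (G.laplacian r)),
      (G.laplacian_isSymmetric r).orthogonal_range, Submodule.mem_orthogonal]
    intro ψ hψ
    have h0 : ∑ e, (ψ (G.tail e) - ψ (G.head e)) ^ 2 / r e = 0 := by
      have := G.inner_laplacian r ψ ψ
      rw [LinearMap.mem_ker.1 hψ, inner_zero_right] at this
      rw [this]
      exact Finset.sum_congr rfl fun e _ => by ring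
    have h1 := h ψ
    rw [h0, mul_zero] at h1
    have h2 : inner ℝ ψ (WithLp.toLp 2 δ) = ∑ v, ψ v * δ v := by
      rw [PiLp.inner_apply]
      exact Finset.sum_congr rfl fun v _ => mul_comm _ _
    rw [h2]
    exact pow_eq_zero_iff two_ne_zero |>.1 (le_antisymm h1 (sq_nonneg _))
  obtain ⟨φ, hφ⟩ := hmem
  have hnet : G.netFlow (fun e => (φ (G.tail e) - φ (G.head e)) / r e) = δ :=
    congrArg WithLp.ofLp hφ
  refine ⟨_, hnet, ?_⟩
  have hen : ∑ e, ((φ (G.tail e) - φ (G.head e)) / r e) ^ 2 * r e =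
      ∑ e, (φ (G.tail e) - φ (G.head e)) ^ 2 / r e := by
    refine Finset.sum_congr rfl fun e _ => ?_
    have := (hr e).ne'
    field_simp
  have hφδ : ∑ v, φ v * δ v = ∑ e, (φ (G.tail e) - φ (G.head e)) ^ 2 / r e := by
    rw [← hnet, sum_mul_netFlow]
    exact Finset.sum_congr rfl fun e _ => by ring
  have h1 := h φ
  rw [hφδ] at h1
  rw [hen]
  by_contra! hlt
  nlinarith

end MultiGraph

/-- Summing a symmetric function that vanishes on the diagonal over unordered pairs gives at most
half of the sum over ordered pairs. -/
theorem sum_sym2_out_le {V : Type*} [Fintype V] {F : V → V → ℝ} (hF : ∀ v w, 0 ≤ F v w)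
    (hsymm : ∀ v w, F v w = F w v) (hdiag : ∀ v, F v v = 0) :
    ∑ e : Sym2 V, F (Quot.out e).1 (Quot.out e).2 ≤ (∑ v, ∑ w, F v w) / 2 := by
  classical
  rw [le_div_iff₀ two_pos, Finset.sum_mul, ← Fintype.sum_prod_type' F,
    ← Finset.sum_fiberwise Finset.univ (fun p : V × V => s(p.1, p.2))]
  refine Finset.sum_le_sum fun e _ => ?_
  have he : s((Quot.out e).1, (Quot.out e).2) = e := Quot.out_eq e
  by_cases hd : (Quot.out e).1 = (Quot.out e).2
  · rw [hd, hdiag, zero_mul]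
    exact Finset.sum_nonneg fun p _ => hF _ _
  · have hne : (Quot.out e) ≠ (Quot.out e).swap := fun h => hd (congrArg Prod.fst h)
    have hsub : ({Quot.out e, (Quot.out e).swap} : Finset (V × V)) ⊆
        Finset.univ.filter fun p : V × V => s(p.1, p.2) = e := by
      intro p hp
      simp only [Finset.mem_insert, Finset.mem_singleton] at hp
      simp only [Finset.mem_filter, Finset.mem_univ, true_and]
      rcases hp with h | h
      · rw [h, he]
      · rw [h, Prod.fst_swap, Prod.snd_swap, Sym2.eq_swap, he]
    refine le_trans (le_of_eq ?_) (Finset.sum_le_sum_of_subset_of_nonneg hsub fun p _ _ => hF _ _)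
    rw [Finset.sum_pair hne, Prod.fst_swap, Prod.snd_swap, hsymm (Quot.out e).2, mul_two]

namespace IsReversibleWalk

variable {V : Type*} [Fintype V] {P : Matrix V V ℝ} {π : V → ℝ}

/-- The Cauchy-Schwarz inequality between the energy of a flow and the Dirichlet form of a
potential. -/
theorem sq_sum_mul_netFlow_le (h : IsReversibleWalk P π)
    [Fintype {e : Sym2 V // 0 < P (Quot.out e).1 (Quot.out e).2}]
    (f : {e : Sym2 V // 0 < P (Quot.out e).1 (Quot.out e).2} → ℝ) (ψ : V → ℝ) :
    (∑ v, ψ v * (transitionGraph P).netFlow f v) ^ 2 ≤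
      (∑ e, f e ^ 2 * transitionResistance P π e) * dirichletForm P π ψ ψ := by
  rw [MultiGraph.sum_mul_netFlow]
  have hpos : ∀ e, 0 < transitionResistance P π e := fun e =>
    one_div_pos.2 (mul_pos (h.weight_pos _) e.2)
  set F : V → V → ℝ := fun v w => π v * P v w * (ψ v - ψ w) ^ 2 with hFdef
  have hF : ∀ v w, 0 ≤ F v w := fun v w =>
    mul_nonneg (mul_nonneg (h.weight_pos v).le (h.nonneg v w)) (sq_nonneg _)
  have hD : ∑ e : {e : Sym2 V // 0 < P (Quot.out e).1 (Quot.out e).2},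
      F (Quot.out e.1).1 (Quot.out e.1).2 ≤ dirichletForm P π ψ ψ := by
    rw [h.dirichletForm_self]
    refine le_trans ?_ (sum_sym2_out_le hF (fun v w => ?_) fun v => ?_)
    · let g : Sym2 V → ℝ := fun e => F (Quot.out e).1 (Quot.out e).2
      exact (Finset.sum_map Finset.univ (Function.Embedding.subtype _) g).symm.trans_le
        (Finset.sum_le_sum_of_subset_of_nonneg (Finset.subset_univ _) fun e _ _ => hF _ _)
    · rw [h.balance v w]; ring
    · simp
  refine le_trans (Finset.sum_sq_le_sum_mul_sum_of_sq_le_mul _ (fun e _ => ?_) (fun e _ => ?_)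
    (fun e _ => ?_)) (mul_le_mul_of_nonneg_left hD (Finset.sum_nonneg fun e _ => ?_))
  · exact mul_nonneg (sq_nonneg _) (hpos e).le
  · exact hF _ _
  · have h1 := (h.weight_pos (Quot.out e.1).1).ne'
    have h2 := e.2.ne'
    refine le_of_eq ?_
    simp only [hFdef, transitionResistance, transitionGraph]
    field_simp
  · exact mul_nonneg (sq_nonneg _) (hpos e).le

/-- A net-flow is small at vertices of small weight, since the weight of a vertex is the total
conductance of its edges. -/
theorem sum_sq_netFlow_div_le (h : IsReversibleWalk P π)
    [Fintype {e : Sym2 V // 0 < P (Quot.out e).1 (Quot.out e).2}]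
    (f : {e : Sym2 V // 0 < P (Quot.out e).1 (Quot.out e).2} → ℝ) :
    ∑ v, (transitionGraph P).netFlow f v ^ 2 / π v ≤
      2 * ∑ e, f e ^ 2 * transitionResistance P π e := by
  set δ := (transitionGraph P).netFlow f
  set X := ∑ v, δ v ^ 2 / π v
  set K := ∑ e, f e ^ 2 * transitionResistance P π e
  have hK : 0 ≤ K := Finset.sum_nonneg fun e _ => mul_nonneg (sq_nonneg _)
    (one_div_pos.2 (mul_pos (h.weight_pos _) e.2)).le
  have h1 := h.sq_sum_mul_netFlow_le f fun v => δ v / π v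
  have h2 := h.dirichletForm_self_le fun v => δ v / π v
  have h3 : ∑ v, δ v / π v * δ v = X := Finset.sum_congr rfl fun v _ => by ring
  have h4 : ∑ v, π v * (δ v / π v) ^ 2 = X := Finset.sum_congr rfl fun v _ => by
    have := (h.weight_pos v).ne'
    field_simp
  rw [h4] at h2
  have h5 : X ^ 2 ≤ K * (2 * X) := by
    rw [← h3]
    exact h1.trans (mul_le_mul_of_nonneg_left (h3 ▸ h2) hK)
  by_contra! hlt
  nlinarith

end IsReversibleWalk

/-! ### The random walk on a graph with resistances -/

namespace MultiGraph

variable {V E : Type*} [Fintype E] {G : MultiGraph V E} {r : E → ℝ}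

open Classical in
theorem sum_conductance_pos (hG : G.IsConnected) (hr : ∀ e, 0 < r e) [Nonempty E] (v : V) :
    0 < ∑ e with G.tail e = v ∨ G.head e = v, 1 / r e := by
  apply Finset.sum_pos fun e _ => one_div_pos.2 (hr e)
  obtain ⟨e₀⟩ := ‹Nonempty E›
  rcases (hG.2 v (G.tail e₀)).cases_head with h | ⟨w, ⟨e, he⟩, -⟩
  · exact ⟨e₀, by simp [h]⟩
  · refine ⟨e, ?_⟩
    have : v ∈ s(G.tail e, G.head e) := he ▸ Sym2.mem_mk_left v w
    simpa [eq_comm] using this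

theorem vertexResistance_pos (hG : G.IsConnected) (hr : ∀ e, 0 < r e) [Nonempty E] (v : V) :
    0 < G.vertexResistance r v :=
  inv_pos.2 (sum_conductance_pos hG hr v)

variable [Fintype V]

open Classical in
theorem sum_walkMatrix (hG : G.IsConnected) (hr : ∀ e, 0 < r e) [Nonempty E] (v : V) :
    ∑ w, G.walkMatrix r v w = 1 := by
  have h1 : ∀ e, ∑ w, (if G.Joins e v w then G.vertexResistance r v / r e else 0) =
      if G.tail e = v ∨ G.head e = v then G.vertexResistance r v / r e else 0 := by
    intro e
    by_cases ht : G.tail e = v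
    · have : ∀ w, G.Joins e v w ↔ G.head e = w := fun w => by
        rw [Joins, ht, Sym2.congr_right]
      simp [this, ht]
    · by_cases hh : G.head e = v
      · have : ∀ w, G.Joins e v w ↔ G.tail e = w := fun w => by
          rw [Joins, hh, Sym2.eq_swap, Sym2.congr_right]
        simp [this, hh]
      · have : ∀ w, ¬ G.Joins e v w := fun w hj => by
          have : v ∈ s(G.tail e, G.head e) := hj ▸ Sym2.mem_mk_left v w
          rcases Sym2.mem_iff.1 this with h | h
          · exact ht h.symm
          · exact hh h.symm
        simp [this, ht, hh]
  simp only [walkMatrix, Finset.sum_filter]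
  rw [Finset.sum_comm]
  simp_rw [h1]
  rw [← Finset.sum_filter]
  simp_rw [div_eq_mul_one_div (G.vertexResistance r v)]
  rw [← Finset.mul_sum, vertexResistance]
  exact inv_mul_cancel₀ (sum_conductance_pos hG hr v).ne'

open Classical in
theorem stationary_mul_walkMatrix (hG : G.IsConnected) (hr : ∀ e, 0 < r e) [Nonempty E]
    (v w : V) : G.stationary r v * G.walkMatrix r v w =
      (∑ u, 1 / G.vertexResistance r u)⁻¹ * ∑ e with G.Joins e v w, 1 / r e := by
  simp only [stationary, walkMatrix, Finset.mul_sum]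
  refine Finset.sum_congr rfl fun e _ => ?_
  have := (vertexResistance_pos hG hr v).ne'
  field_simp

theorem sum_inv_vertexResistance_pos (hG : G.IsConnected) (hr : ∀ e, 0 < r e) [Nonempty E] :
    0 < ∑ u, 1 / G.vertexResistance r u :=
  have := hG.1
  Finset.sum_pos (fun u _ => one_div_pos.2 (vertexResistance_pos hG hr u)) Finset.univ_nonempty

open Classical in
theorem isReversibleWalk_walkMatrix (hG : G.IsConnected) (hr : ∀ e, 0 < r e) [Nonempty E] :
    IsReversibleWalk (G.walkMatrix r) (G.stationary r) where
  weight_pos v := div_pos (inv_pos.2 (sum_inv_vertexResistance_pos hG hr))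
    (vertexResistance_pos hG hr v)
  nonneg v w := Finset.sum_nonneg fun e _ =>
    div_nonneg (vertexResistance_pos hG hr v).le (hr e).le
  row_sum := sum_walkMatrix hG hr
  balance v w := by
    rw [stationary_mul_walkMatrix hG hr, stationary_mul_walkMatrix hG hr]
    congr 2
    ext e
    rw [Finset.mem_filter, Finset.mem_filter, Joins, Joins, Sym2.eq_swap (a := v)]

theorem sum_stationary (hG : G.IsConnected) (hr : ∀ e, 0 < r e) [Nonempty E] :
    ∑ v, G.stationary r v = 1 := by
  simp only [stationary]
  simp_rw [div_eq_mul_one_div (∑ u, 1 / G.vertexResistance r u)⁻¹]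
  rw [← Finset.mul_sum]
  exact inv_mul_cancel₀ (sum_inv_vertexResistance_pos hG hr).ne'

/-- Every edge contributes to the conductance of at least one vertex. -/
theorem sum_inv_le_sum_inv_vertexResistance (hr : ∀ e, 0 < r e) :
    ∑ e, (r e)⁻¹ ≤ ∑ u, 1 / G.vertexResistance r u := by
  classical
  rw [← Finset.sum_fiberwise Finset.univ G.tail]
  refine Finset.sum_le_sum fun u _ => ?_
  simp only [vertexResistance, one_div, inv_inv]
  refine le_trans (le_of_eq ?_) (Finset.sum_le_sum_of_subset_of_nonneg
    (s := Finset.univ.filter fun e => G.tail e = u) ?_ fun e _ _ => (inv_pos.2 (hr e)).le)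
  · rfl
  · intro e
    simp only [Finset.mem_filter, Finset.mem_univ, true_and]
    exact Or.inl

theorem dirichletForm_walkMatrix_le (hG : G.IsConnected) (hr : ∀ e, 0 < r e) [Nonempty E]
    (ψ : V → ℝ) : dirichletForm (G.walkMatrix r) (G.stationary r) ψ ψ ≤
      (∑ u, 1 / G.vertexResistance r u)⁻¹ * ∑ e, (ψ (G.tail e) - ψ (G.head e)) ^ 2 / r e := by
  classical
  rw [(isReversibleWalk_walkMatrix hG hr).dirichletForm_self]
  simp_rw [stationary_mul_walkMatrix hG hr, mul_assoc, ← Finset.mul_sum]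
  rw [mul_div_assoc]
  refine mul_le_mul_of_nonneg_left ?_ (inv_pos.2 (sum_inv_vertexResistance_pos hG hr)).le
  rw [div_le_iff₀ two_pos, Finset.sum_mul]
  simp_rw [Finset.sum_mul, Finset.sum_filter]
  rw [← Fintype.sum_prod_type' (fun v w => ∑ e, if G.Joins e v w then
    1 / r e * (ψ v - ψ w) ^ 2 else 0), Finset.sum_comm]
  refine Finset.sum_le_sum fun e _ => ?_
  rw [← Finset.sum_filter]
  have hval : ∀ p ∈ Finset.univ.filter fun p : V × V => G.Joins e p.1 p.2,
      1 / r e * (ψ p.1 - ψ p.2) ^ 2 = (ψ (G.tail e) - ψ (G.head e)) ^ 2 / r e := by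
    intro p hp
    rcases Sym2.eq_iff.1 (Finset.mem_filter.1 hp).2 with ⟨h1, h2⟩ | ⟨h1, h2⟩
    · rw [h1, h2]; ring
    · rw [h1, h2]; ring
  have hcard : (Finset.univ.filter fun p : V × V => G.Joins e p.1 p.2).card ≤ 2 := by
    refine (Finset.card_le_card (t := {(G.tail e, G.head e), (G.head e, G.tail e)}) ?_).trans
      Finset.card_le_two
    intro p hp
    rcases Sym2.eq_iff.1 (Finset.mem_filter.1 hp).2 with ⟨h1, h2⟩ | ⟨h1, h2⟩ <;>
      simp [h1, h2]
  rw [Finset.sum_congr rfl hval, Finset.sum_const, nsmul_eq_mul, mul_comm]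
  refine mul_le_mul_of_nonneg_left (by exact_mod_cast hcard)
    (div_nonneg (sq_nonneg _) (hr e).le)

/-- A flow of energy less than `R'` for `t` steps of the walk gives a flow with the same net-flow
and of energy at most `2 t R'` on the graph. The distribution `ν` in which it ends cannot be much
more concentrated than `σ + π`, because `ν - σ` is small where the stationary distribution `π` is.
With `R < R'`, it does not matter whether the infimum in the effective resistance is attained. -/
theorem exists_flow_of_markovResistanceToSet_le [DecidableEq V] (hG : G.IsConnected)
    (hr : ∀ e, 0 < r e) (hsum : ∑ e, (r e)⁻¹ = 1 / 2) {σ : V → ℝ} (hσ : σ ∈ stdSimplex ℝ V)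
    {M : Set V} {t : ℕ} {R R' : ℝ} (hR : 0 ≤ R) (hRR' : R < R')
    (h : markovResistanceToSet (G.walkMatrix r ^ t) (G.stationary r) σ M ≤ ENNReal.ofReal R) :
    ∃ ν ∈ stdSimplex ℝ V, (∀ v ∉ M, ν v = 0) ∧
      (∃ g : E → ℝ, G.netFlow g = σ - ν ∧ ∑ e, g e ^ 2 * r e ≤ 2 * (t * R')) ∧
      ∑ v, ν v ^ 2 / (σ v + G.stationary r v) ≤ 2 + 4 * R' := by
  have hE : Nonempty E := by
    by_contra hE
    rw [not_nonempty_iff] at hE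
    simp at hsum
  have hP := isReversibleWalk_walkMatrix hG hr
  have hPt := hP.pow t
  have hlt := h.trans_lt ((ENNReal.ofReal_lt_ofReal_iff (hR.trans_lt hRR')).2 hRR')
  rw [markovResistanceToSet] at hlt
  simp only [iInf_lt_iff] at hlt
  obtain ⟨ν, ⟨hν, hνM⟩, hlt⟩ := hlt
  rw [markovResistance, effectiveResistance] at hlt
  simp only [iInf_lt_iff] at hlt
  obtain ⟨f, hf, hlt⟩ := hlt
  rw [ENNReal.ofReal_lt_ofReal_iff (hR.trans_lt hRR')] at hlt
  let _ : Fintype {e : Sym2 V // 0 < (G.walkMatrix r ^ t) (Quot.out e).1 (Quot.out e).2} :=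
    Fintype.ofFinite _
  have hf' : (transitionGraph (G.walkMatrix r ^ t)).netFlow f = σ - ν := Set.mem_ofPred_eq.mp hf
  refine ⟨ν, hν, hνM, ?_, ?_⟩
  · apply exists_flow_of_forall_potential G hr _
      (mul_nonneg zero_le_two (mul_nonneg t.cast_nonneg (hR.trans hRR'.le)))
    intro ψ
    have h1 := hPt.sq_sum_mul_netFlow_le f ψ
    rw [hf'] at h1
    have h2 := hP.dirichletForm_pow_le ψ t
    have h3 := dirichletForm_walkMatrix_le hG hr ψ
    -- a loop counts only once in the conductance of its vertex, so the sum may be less than `1`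
    have h4 : (∑ u, 1 / G.vertexResistance r u)⁻¹ ≤ 2 := by
      rw [inv_le_comm₀ (sum_inv_vertexResistance_pos hG hr) two_pos]
      have := sum_inv_le_sum_inv_vertexResistance (G := G) hr
      rw [hsum] at this
      linarith
    have h5 : 0 ≤ ∑ e, (ψ (G.tail e) - ψ (G.head e)) ^ 2 / r e :=
      Finset.sum_nonneg fun e _ => div_nonneg (sq_nonneg _) (hr e).le
    set Y := ∑ e, (ψ (G.tail e) - ψ (G.head e)) ^ 2 / r e
    calc _ ≤ _ := h1
      _ ≤ R' * (t * (2 * Y)) := by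
        refine mul_le_mul hlt.le ?_ (hPt.dirichletForm_self_nonneg ψ) (hR.trans hRR'.le)
        refine h2.trans (mul_le_mul_of_nonneg_left (h3.trans ?_) t.cast_nonneg)
        exact mul_le_mul_of_nonneg_right h4 h5
      _ = _ := by ring
  · have h1 := hPt.sum_sq_netFlow_div_le f
    rw [hf'] at h1
    have h2 : ∀ v, ν v ^ 2 / (σ v + G.stationary r v) ≤
        2 * σ v + 2 * ((σ - ν) v ^ 2 / G.stationary r v) := by
      intro v
      have hπ := hP.weight_pos v
      have hs := hσ.1 v
      have h3 : (σ - ν) v ^ 2 / G.stationary r v * G.stationary r v = (σ - ν) v ^ 2 :=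
        div_mul_cancel₀ _ hπ.ne'
      have h4 : 0 ≤ (σ - ν) v ^ 2 / G.stationary r v := div_nonneg (sq_nonneg _) hπ.le
      rw [div_le_iff₀ (by linarith)]
      rw [Pi.sub_apply] at *
      nlinarith [sq_nonneg (2 * σ v - ν v), mul_nonneg hs hπ.le, mul_nonneg h4 hs]
    calc _ ≤ ∑ v, (2 * σ v + 2 * ((σ - ν) v ^ 2 / G.stationary r v)) :=
          Finset.sum_le_sum fun v _ => h2 v
      _ = 2 + 2 * ∑ v, (σ - ν) v ^ 2 / G.stationary r v := by
          rw [Finset.sum_add_distrib, ← Finset.mul_sum, ← Finset.mul_sum, hσ.2, mul_one]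
      _ ≤ _ := by linarith

end MultiGraph

/-! ### Composition of the routines -/

theorem le_iSup_iSup_of_finite {ι κ : Type*} [Finite ι] [Finite κ] (F : ι → κ → ℝ) (i : ι)
    (j : κ) : F i j ≤ ⨆ i, ⨆ j, F i j :=
  (le_ciSup (Finite.bddAbove_range (F i)) j).trans
    (le_ciSup (Finite.bddAbove_range fun i => ⨆ j, F i j) i)

/-- Rescaling balances two witness sizes at their geometric mean, up to `ε` in case one of them is
zero. -/
theorem exists_balancing_scale {A B ε : ℝ} (hA : 0 ≤ A) (hB : 0 ≤ B) (hε : 0 < ε) :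
    ∃ s : ℝ, 0 < s ∧ s ^ 2 * A ≤ √(A * B) + ε ∧ s⁻¹ ^ 2 * B ≤ √(A * B) + ε := by
  suffices ∃ m : ℝ, 0 < m ∧ m * A ≤ √(A * B) + ε ∧ m⁻¹ * B ≤ √(A * B) + ε by
    obtain ⟨m, hm, h1, h2⟩ := this
    exact ⟨√m, Real.sqrt_pos.2 hm, by rwa [Real.sq_sqrt hm.le],
      by rwa [inv_pow, Real.sq_sqrt hm.le]⟩
  have hpos : 0 < √(A * B) + ε := add_pos_of_nonneg_of_pos (Real.sqrt_nonneg _) hε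
  rcases hA.eq_or_lt with rfl | hA
  · refine ⟨(B + 1) / ε, by positivity, by simpa using hε.le, ?_⟩
    rw [zero_mul, Real.sqrt_zero, zero_add, inv_div, div_mul_eq_mul_div,
      div_le_iff₀ (by positivity)]
    nlinarith
  · refine ⟨(√(A * B) + ε) / A, by positivity, (div_mul_cancel₀ _ hA.ne').le, ?_⟩
    rw [inv_div, div_mul_eq_mul_div, div_le_iff₀ hpos]
    nlinarith [Real.mul_self_sqrt (mul_nonneg hA.le hB), Real.sqrt_nonneg (A * B)]

/-- The simp lemma `inner_smul_left` does not apply to tensor products, because the scalar action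
found on them unfolds to that of the inner product space only at default transparency. -/
theorem inner_tensor_smul_left {ℳ 𝒲 : Type*} [NormedAddCommGroup ℳ] [InnerProductSpace ℂ ℳ]
    [NormedAddCommGroup 𝒲] [InnerProductSpace ℂ 𝒲] (c : ℂ) (x y : ℳ ⊗[ℂ] 𝒲) :
    inner ℂ (c • x) y = starRingEnd ℂ c * inner ℂ x y :=
  inner_smul_left x y c

/-- See `inner_tensor_smul_left`. -/
theorem inner_tensor_smul_right {ℳ 𝒲 : Type*} [NormedAddCommGroup ℳ] [InnerProductSpace ℂ ℳ]
    [NormedAddCommGroup 𝒲] [InnerProductSpace ℂ 𝒲] (c : ℂ) (x y : ℳ ⊗[ℂ] 𝒲) :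
    inner ℂ x (c • y) = c * inner ℂ x y :=
  inner_smul_right x y c

namespace QuantumWalkSearch

variable {V E 𝒟 𝒮 : Type*} [Fintype V] [Fintype E] [Fintype 𝒮]
  {MS WS : V → Type*} {MU WU : E → Type*} {HC : V → 𝒮 → Type*}
  [∀ v, NormedAddCommGroup (MS v)] [∀ v, InnerProductSpace ℂ (MS v)]
  [∀ v, FiniteDimensional ℂ (MS v)]
  [∀ v, NormedAddCommGroup (WS v)] [∀ v, InnerProductSpace ℂ (WS v)]
  [∀ e, NormedAddCommGroup (MU e)] [∀ e, InnerProductSpace ℂ (MU e)]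
  [∀ e, FiniteDimensional ℂ (MU e)]
  [∀ e, NormedAddCommGroup (WU e)] [∀ e, InnerProductSpace ℂ (WU e)]
  [∀ v D, NormedAddCommGroup (HC v D)] [∀ v D, InnerProductSpace ℂ (HC v D)]
  (Q : QuantumWalkSearch V E 𝒟 𝒮 MS WS MU WU HC)

open Classical in
/-- The combination of vectors for the setup, update and checking routines with real coefficients
`s`, `u` and `k`. Among the checking routines of `v`, only the one for the database entry of the
input `x` takes part. -/
noncomputable def combine (x : 𝒟) (s : V → ℝ) (u : E → ℝ) (k : V → ℝ) (S : ∀ v, MS v ⊗[ℂ] WS v)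
    (U : ∀ e, MU e ⊗[ℂ] WU e) (C : ∀ v D, HC v D) : Q.Space :=
  WithLp.toLp 2 (WithLp.toLp 2 fun v => (s v : ℂ) • S v,
    WithLp.toLp 2 (WithLp.toLp 2 fun e => (u e : ℂ) • U e,
      WithLp.toLp 2 fun q : V × 𝒮 => if q.2 = Q.entry q.1 x then (k q.1 : ℂ) • C q.1 q.2 else 0))

variable {Q}

open Classical in
theorem inner_combine (x y : 𝒟) (s s' : V → ℝ) (u u' : E → ℝ) (k k' : V → ℝ)
    (S S' : ∀ v, MS v ⊗[ℂ] WS v) (U U' : ∀ e, MU e ⊗[ℂ] WU e) (C C' : ∀ v D, HC v D) :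
    inner ℂ (Q.combine x s u k S U C) (Q.combine y s' u' k' S' U' C') =
      ∑ v, (s v * s' v : ℂ) * inner ℂ (S v) (S' v) +
      (∑ e, (u e * u' e : ℂ) * inner ℂ (U e) (U' e) +
      ∑ v, if Q.entry v x = Q.entry v y then (k v * k' v : ℂ) *
        inner ℂ (C v (Q.entry v x)) (C' v (Q.entry v x)) else 0) := by
  rw [combine, combine, WithLp.prod_inner_apply, WithLp.prod_inner_apply, PiLp.inner_apply,
    PiLp.inner_apply, PiLp.inner_apply, Fintype.sum_prod_type]
  congr 1
  · refine Finset.sum_congr rfl fun v _ => ?_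
    simp only [inner_tensor_smul_left, inner_tensor_smul_right, Complex.conj_ofReal]
    ring
  congr 1
  · refine Finset.sum_congr rfl fun v _ => ?_
    simp only [inner_tensor_smul_left, inner_tensor_smul_right, Complex.conj_ofReal]
    ring
  · refine Finset.sum_congr rfl fun v _ => ?_
    rw [Finset.sum_eq_single (Q.entry v x)]
    · by_cases h : Q.entry v x = Q.entry v y
      · simp only [if_true, h, inner_smul_left, inner_smul_right, Complex.conj_ofReal]
        ring
      · simp [h]
    · intro D _ hD
      simp [hD]
    · simp

theorem sq_norm_combine (x : 𝒟) (s : V → ℝ) (u : E → ℝ) (k : V → ℝ)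
    (S : ∀ v, MS v ⊗[ℂ] WS v) (U : ∀ e, MU e ⊗[ℂ] WU e) (C : ∀ v D, HC v D) :
    ‖Q.combine x s u k S U C‖ ^ 2 = ∑ v, s v ^ 2 * ‖S v‖ ^ 2 +
      (∑ e, u e ^ 2 * ‖U e‖ ^ 2 + ∑ v, k v ^ 2 * ‖C v (Q.entry v x)‖ ^ 2) := by
  have h := inner_combine (Q := Q) x x s s u u k k S S U U C C
  have hS : ∀ v, inner ℂ (S v) (S v) = (‖S v‖ : ℂ) ^ 2 := fun v =>
    inner_self_eq_norm_sq_to_K (𝕜 := ℂ) (S v)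
  have hU : ∀ e, inner ℂ (U e) (U e) = (‖U e‖ : ℂ) ^ 2 := fun e =>
    inner_self_eq_norm_sq_to_K (𝕜 := ℂ) (U e)
  have hC : ∀ v D, inner ℂ (C v D) (C v D) = (‖C v D‖ : ℂ) ^ 2 := fun v D =>
    inner_self_eq_norm_sq_to_K _
  simp only [hS, hU, hC, if_true, ← sq] at h
  have h' : (‖Q.combine x s u k S U C‖ : ℂ) ^ 2 = _ :=
    (inner_self_eq_norm_sq_to_K (𝕜 := ℂ) (Q.combine x s u k S U C)).symm.trans h
  exact_mod_cast h'

open Classical in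
theorem combine_mem_inputSpace {x : 𝒟} {s : V → ℝ} {u : E → ℝ} {k : V → ℝ}
    {C : ∀ v D, HC v D}
    (hC : ∀ v, k v ≠ 0 → C v (Q.entry v x) ∈ (Q.check v (Q.entry v x)).inputSpace x) :
    Q.combine x s u k (fun v => (Q.setup v).posWitness x) (fun e => (Q.update e).posWitness x) C ∈
      Q.inputSpace x := by
  refine ⟨fun v => Submodule.smul_mem _ _ ((Q.setup v).posWitness_mem x),
    fun e => Submodule.smul_mem _ _ ((Q.update e).posWitness_mem x), ?_⟩
  rintro ⟨v, D⟩
  change (if D = Q.entry v x then (k v : ℂ) • C v D else 0) ∈ _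
  split_ifs with hD
  · subst hD
    by_cases hk : k v = 0
    · simp [hk]
    · exact Submodule.smul_mem _ _ (hC v hk)
  · exact zero_mem _

open Classical in
theorem combine_mem_inputSpace_orthogonal {x : 𝒟} {s : V → ℝ} {u : E → ℝ} {k : V → ℝ}
    {C : ∀ v D, HC v D}
    (hC : ∀ v, C v (Q.entry v x) ∈ ((Q.check v (Q.entry v x)).inputSpace x)ᗮ) :
    Q.combine x s u k (fun v => (Q.setup v).negWitness x) (fun e => (Q.update e).negWitness x) C ∈
      (Q.inputSpace x)ᗮ := by
  rw [Submodule.mem_orthogonal]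
  intro h hh
  rw [combine, WithLp.prod_inner_apply, WithLp.prod_inner_apply, PiLp.inner_apply,
    PiLp.inner_apply, PiLp.inner_apply]
  have h1 : ∀ v, inner ℂ (h.fst v) ((s v : ℂ) • (Q.setup v).negWitness x) = 0 := fun v => by
    rw [inner_tensor_smul_right, (Q.setup v).inner_negWitness_eq_zero (hh.1 v), mul_zero]
  have h2 : ∀ e, inner ℂ (h.snd.fst e) ((u e : ℂ) • (Q.update e).negWitness x) = 0 := fun e => by
    rw [inner_tensor_smul_right, (Q.update e).inner_negWitness_eq_zero (hh.2.1 e), mul_zero]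
  have h3 : ∀ q : V × 𝒮, inner ℂ (h.snd.snd q)
      (if q.2 = Q.entry q.1 x then (k q.1 : ℂ) • C q.1 q.2 else 0) = 0 := by
    rintro ⟨v, D⟩
    split_ifs with hD
    · dsimp only at hD
      subst hD
      rw [inner_smul_right, hC v _ (hh.2.2 (v, Q.entry v x)), mul_zero]
    · exact inner_zero_right _
  exact (congrArg₂ (· + ·) (Finset.sum_eq_zero fun v _ => h1 v)
    ((congrArg₂ (· + ·) (Finset.sum_eq_zero fun e _ => h2 e)
      (Finset.sum_eq_zero fun q _ => h3 q)).trans (add_zero 0))).trans (add_zero 0)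

open Classical in
theorem inner_setup (v : V) (x y : 𝒟) :
    inner ℂ ((Q.setup v).posWitness x) ((Q.setup v).negWitness y) =
      1 - (if Q.entry v x = Q.entry v y then 1 else 0 : ℂ) := by
  rw [StateReflection.Solution.inner_posWitness_negWitness,
    HyperedgeProblem.inner_flow_potential_databaseUpdate]
  simp

open Classical in
theorem inner_update (e : E) (x y : 𝒟) :
    inner ℂ ((Q.update e).posWitness x) ((Q.update e).negWitness y) =
      (if Q.entry (Q.G.tail e) x = Q.entry (Q.G.tail e) y then 1 else 0 : ℂ) -
        (if Q.entry (Q.G.head e) x = Q.entry (Q.G.head e) y then 1 else 0) := by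
  rw [StateReflection.Solution.inner_posWitness_negWitness,
    HyperedgeProblem.inner_flow_potential_databaseUpdate]
  by_cases h : Q.G.tail e = Q.G.head e
  · simp [h]
  · simp [h, Ne.symm h]

/-- The composed positive witness for `x` and negative witness for `y` have inner product `1`. With
`m v = 1` if the entries of `x` and `y` at `v` agree and `m v = 0` otherwise, the setup routines
contribute `∑ σ (1 - m)`, the update routines `∑ m (σ - ν)`, as `g` has net-flow `σ - ν`, and the
checking routines `∑ ν m`. -/
theorem inner_combine_eq_one {σ ν : V → ℝ} {g : E → ℝ} (hσ : ∑ v, σ v = 1)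
    (hg : Q.G.netFlow g = σ - ν) {x y : 𝒟} {s s' k k' : V → ℝ} {u u' : E → ℝ}
    {C C' : ∀ v D, HC v D} (hs : ∀ v, s v * s' v = σ v) (hu : ∀ e, u e * u' e = g e)
    (hk : ∀ v, k v * k' v = ν v)
    (hC : ∀ v, ν v ≠ 0 → Q.entry v x = Q.entry v y →
      inner ℂ (C v (Q.entry v x)) (C' v (Q.entry v x)) = 1) :
    inner ℂ
      (Q.combine x s u k (fun v => (Q.setup v).posWitness x)
        (fun e => (Q.update e).posWitness x) C)
      (Q.combine y s' u' k' (fun v => (Q.setup v).negWitness y)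
        (fun e => (Q.update e).negWitness y) C') = 1 := by
  classical
  rw [inner_combine]
  set m : V → ℝ := fun v => if Q.entry v x = Q.entry v y then 1 else 0 with hm
  have h1 : ∀ v, (s v * s' v : ℂ) * inner ℂ ((Q.setup v).posWitness x)
      ((Q.setup v).negWitness y) = ((σ v * (1 - m v) : ℝ) : ℂ) := fun v => by
    rw [inner_setup, ← hs v, hm]
    push_cast
    split_ifs <;> simp
  have h2 : ∀ e, (u e * u' e : ℂ) * inner ℂ ((Q.update e).posWitness x)
      ((Q.update e).negWitness y) =
      ((g e * (m (Q.G.tail e) - m (Q.G.head e)) : ℝ) : ℂ) := fun e => by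
    rw [inner_update, ← hu e, hm]
    push_cast
    split_ifs <;> simp
  have h3 : ∀ v, (if Q.entry v x = Q.entry v y then (k v * k' v : ℂ) *
      inner ℂ (C v (Q.entry v x)) (C' v (Q.entry v x)) else 0) = ((ν v * m v : ℝ) : ℂ) := by
    intro v
    by_cases h : Q.entry v x = Q.entry v y
    · by_cases hν : ν v = 0
      · have : (k v * k' v : ℂ) = 0 := by exact_mod_cast (hk v).trans hν
        simp [this, hν]
      · have hkc : (k v * k' v : ℂ) = (ν v : ℂ) := by exact_mod_cast hk v
        rw [if_pos h, hC v hν h, hkc]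
        simp [hm, h]
    · simp [hm, h]
  simp_rw [h1, h2, h3]
  have key : ∑ v, σ v * (1 - m v) + (∑ e, g e * (m (Q.G.tail e) - m (Q.G.head e)) +
      ∑ v, ν v * m v) = 1 := by
    rw [← MultiGraph.sum_mul_netFlow, hg, ← Finset.sum_add_distrib, ← Finset.sum_add_distrib]
    refine Eq.trans (Finset.sum_congr rfl fun v _ => ?_) hσ
    rw [Pi.sub_apply]
    ring
  exact_mod_cast key

theorem nonempty_edges (Q : QuantumWalkSearch V E 𝒟 𝒮 MS WS MU WU HC) : Nonempty E := by
  by_contra hE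
  rw [not_nonempty_iff] at hE
  have := Q.sum_inv_r
  simp at this

/-- If no input has marked vertices, then a single vertex and its checking routines suffice. -/
theorem exists_spanProgram_of_forall_not [Finite 𝒟] (h : ∀ x, ¬ (Q.marked x).Nonempty) :
    ∃ P : SpanProgram 𝒟 Q.Space, P.inputSpace = Q.inputSpace ∧
      P.Computes (fun x => (Q.marked x).Nonempty) := by
  classical
  obtain ⟨v₀⟩ := Q.connected.1
  have hneg : ∀ v x, (Q.check v (Q.entry v x)).IsNegative x := fun v x =>
    (Q.check_correct v _ x rfl).2 fun hv => h x ⟨v, hv⟩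
  have : ∀ v D x, ∃ w : HC v D, D = Q.entry v x → w ∈ (Q.check v D).negWitnesses x := by
    intro v D x
    by_cases hD : D = Q.entry v x
    · subst hD
      obtain ⟨w, hw⟩ := hneg v x
      exact ⟨w, fun _ => hw⟩
    · exact ⟨0, fun h => absurd h hD⟩
  choose wn hwn using this
  let p₀ : Q.Space := WithLp.toLp 2 (0, WithLp.toLp 2 (0,
    WithLp.toLp 2 fun q : V × 𝒮 => (Q.check q.1 q.2).initial))
  let n : 𝒟 → Q.Space := fun y => Q.combine y 0 0 (Pi.single v₀ 1)
    (fun v => (Q.setup v).negWitness y) (fun e => (Q.update e).negWitness y) fun v D => wn v D y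
  have hp₀ : ∀ y, inner ℂ p₀ (n y) = 1 := fun y => by
    have hcheck : ∑ q : V × 𝒮, inner ℂ (Q.check q.1 q.2).initial
        (if q.2 = Q.entry q.1 y then (((Pi.single v₀ 1 : V → ℝ) q.1 : ℝ) : ℂ) • wn q.1 q.2 y
          else 0) = 1 := by
      rw [Finset.sum_eq_single (v₀, Q.entry v₀ y)]
      · simp [(hwn v₀ _ y rfl).2.2]
      · rintro ⟨v, D⟩ - hne
        by_cases hv : v = v₀
        · subst hv
          have : D ≠ Q.entry v y := fun h => hne (by rw [h])
          simp [this]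
        · simp [hv]
      · simp
    have hsetup : ∀ v, inner ℂ (0 : MS v ⊗[ℂ] WS v) ((n y).fst v) = 0 := fun v =>
      inner_zero_left _
    have hupdate : ∀ e, inner ℂ (0 : MU e ⊗[ℂ] WU e) ((n y).snd.fst e) = 0 := fun e =>
      inner_zero_left _
    simp only [n, p₀]
    rw [combine, WithLp.prod_inner_apply, WithLp.prod_inner_apply, PiLp.inner_apply,
      PiLp.inner_apply, PiLp.inner_apply]
    exact (congrArg₂ (· + ·) (Finset.sum_eq_zero fun v _ => hsetup v)
      ((congrArg₂ (· + ·) (Finset.sum_eq_zero fun e _ => hupdate e) hcheck).trans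
        (zero_add 1))).trans (zero_add 1)
  obtain ⟨P, hP1, hP2, -⟩ := SpanProgram.exists_of_witnesses Q.inputSpace
    (fun x => (Q.marked x).Nonempty) (fun _ => 0) n p₀ (fun x hx => absurd hx (h x))
    (fun y _ => combine_mem_inputSpace_orthogonal fun v => (hwn v _ y rfl).1)
    (fun x _ hx => absurd hx (h x)) (fun y _ => hp₀ y)
  exact ⟨P, hP1, hP2⟩

/-- The composed span program, with the three kinds of routines rescaled separately. Besides the
flow `g x`, the weights are `σ` for the setup routines, the conductances for the update routines,
and the total `σ + π` of the initial and the stationary distribution for the checking routines. -/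
theorem exists_spanProgram_complexity_le [Finite 𝒟] {σ : V → ℝ} (hσ : σ ∈ stdSimplex ℝ V)
    {ν : 𝒟 → V → ℝ} {g : 𝒟 → E → ℝ} {A B : ℝ}
    (hν : ∀ x, (Q.marked x).Nonempty → ∀ v ∉ Q.marked x, ν x v = 0)
    (hg : ∀ x, (Q.marked x).Nonempty → Q.G.netFlow (g x) = σ - ν x)
    (hA : ∀ x, (Q.marked x).Nonempty → ∑ e, g x e ^ 2 * Q.r e ≤ A)
    (hB : ∀ x, (Q.marked x).Nonempty → ∑ v, ν x v ^ 2 / (σ v + Q.stationary v) ≤ B)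
    (hx₀ : ∃ x, (Q.marked x).Nonempty) {ε : ℝ} (hε : 0 < ε) :
    ∃ P : SpanProgram 𝒟 Q.Space, P.inputSpace = Q.inputSpace ∧
      P.Computes (fun x => (Q.marked x).Nonempty) ∧
      P.complexity ≤
        √((⨆ v, ⨆ x, (Q.setup v).posSize x) * ⨆ v, ⨆ x, (Q.setup v).negSize x) +
        √(A * (⨆ e, ⨆ x, (Q.update e).posSize x) * (1 / 2 * ⨆ e, ⨆ x, (Q.update e).negSize x)) +
        √(B * ((⨆ v, ⨆ x, (Q.check v (Q.entry v x)).posSize x) + ε) *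
          (2 * ((⨆ v, ⨆ x, (Q.check v (Q.entry v x)).negSize x) + ε))) + 3 * ε := by
  have := Q.nonempty_edges
  have hP := MultiGraph.isReversibleWalk_walkMatrix Q.connected Q.r_pos
  obtain ⟨x₀, hx₀⟩ := hx₀
  have hκ : ∀ v, 0 < σ v + Q.stationary v := fun v =>
    add_pos_of_nonneg_of_pos (hσ.1 v) (hP.weight_pos v)
  have hA₀ : 0 ≤ A := (Finset.sum_nonneg fun e _ => mul_nonneg (sq_nonneg _)
    (Q.r_pos e).le).trans (hA x₀ hx₀)
  have hB₀ : 0 ≤ B := (Finset.sum_nonneg fun v _ => div_nonneg (sq_nonneg _)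
    (hκ v).le).trans (hB x₀ hx₀)
  have hSP := le_iSup_iSup_of_finite fun v x => (Q.setup v).posSize x
  have hSN := le_iSup_iSup_of_finite fun v x => (Q.setup v).negSize x
  have hUP := le_iSup_iSup_of_finite fun e x => (Q.update e).posSize x
  have hUN := le_iSup_iSup_of_finite fun e x => (Q.update e).negSize x
  have hCP := le_iSup_iSup_of_finite fun v x => (Q.check v (Q.entry v x)).posSize x
  have hCN := le_iSup_iSup_of_finite fun v x => (Q.check v (Q.entry v x)).negSize x
  have hSP₀ : 0 ≤ ⨆ v, ⨆ x, (Q.setup v).posSize x :=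
    Real.iSup_nonneg fun v => Real.iSup_nonneg fun x => (Q.setup v).posSize_nonneg x
  have hSN₀ : 0 ≤ ⨆ v, ⨆ x, (Q.setup v).negSize x :=
    Real.iSup_nonneg fun v => Real.iSup_nonneg fun x => (Q.setup v).negSize_nonneg x
  have hUP₀ : 0 ≤ ⨆ e, ⨆ x, (Q.update e).posSize x :=
    Real.iSup_nonneg fun e => Real.iSup_nonneg fun x => (Q.update e).posSize_nonneg x
  have hUN₀ : 0 ≤ ⨆ e, ⨆ x, (Q.update e).negSize x :=
    Real.iSup_nonneg fun e => Real.iSup_nonneg fun x => (Q.update e).negSize_nonneg x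
  have hCP₀ : 0 ≤ ⨆ v, ⨆ x, (Q.check v (Q.entry v x)).posSize x :=
    Real.iSup_nonneg fun v => Real.iSup_nonneg fun x => SpanProgram.posSize_nonneg _ x
  have hCN₀ : 0 ≤ ⨆ v, ⨆ x, (Q.check v (Q.entry v x)).negSize x :=
    Real.iSup_nonneg fun v => Real.iSup_nonneg fun x => SpanProgram.negSize_nonneg _ x
  set SP := ⨆ v, ⨆ x, (Q.setup v).posSize x
  set SN := ⨆ v, ⨆ x, (Q.setup v).negSize x
  set UP := ⨆ e, ⨆ x, (Q.update e).posSize x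
  set UN := ⨆ e, ⨆ x, (Q.update e).negSize x
  set CP := ⨆ v, ⨆ x, (Q.check v (Q.entry v x)).posSize x
  set CN := ⨆ v, ⨆ x, (Q.check v (Q.entry v x)).negSize x
  have hwp : ∀ v D x, ∃ w : HC v D, D = Q.entry v x → v ∈ Q.marked x →
      w ∈ (Q.check v D).posWitnesses x ∧ ‖w‖ ^ 2 ≤ CP + ε := by
    intro v D x
    by_cases h : D = Q.entry v x ∧ v ∈ Q.marked x
    · obtain ⟨rfl, hv⟩ := h
      obtain ⟨w, hw, hlt⟩ := SpanProgram.exists_posWitness_lt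
        ((Q.check_correct v _ x rfl).1 hv) (lt_add_of_pos_right _ hε)
      exact ⟨w, fun _ _ => ⟨hw, hlt.le.trans (add_le_add_left (hCP v x) ε)⟩⟩
    · exact ⟨0, fun h1 h2 => absurd ⟨h1, h2⟩ h⟩
  have hwn : ∀ v D y, ∃ w : HC v D, D = Q.entry v y → v ∉ Q.marked y →
      w ∈ (Q.check v D).negWitnesses y ∧ ‖w‖ ^ 2 ≤ CN + ε := by
    intro v D y
    by_cases h : D = Q.entry v y ∧ v ∉ Q.marked y
    · obtain ⟨rfl, hv⟩ := h
      obtain ⟨w, hw, hlt⟩ := SpanProgram.exists_negWitness_lt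
        ((Q.check_correct v _ y rfl).2 hv) (lt_add_of_pos_right _ hε)
      exact ⟨w, fun _ _ => ⟨hw, hlt.le.trans (add_le_add_left (hCN v y) ε)⟩⟩
    · exact ⟨0, fun h1 h2 => absurd ⟨h1, h2⟩ h⟩
  choose wp hwp using hwp
  choose wn hwn using hwn
  have hν' : ∀ x, (Q.marked x).Nonempty → ∀ v, ν x v ≠ 0 → v ∈ Q.marked x := fun x hx v h =>
    by_contra fun hv => h (hν x hx v hv)
  have hunmarked : ∀ y, ¬ (Q.marked y).Nonempty → ∀ v, v ∉ Q.marked y := fun y hy v hv =>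
    hy ⟨v, hv⟩
  obtain ⟨a, ha, ha1, ha2⟩ := exists_balancing_scale hSP₀ hSN₀ hε
  obtain ⟨b, hb, hb1, hb2⟩ := exists_balancing_scale (mul_nonneg hA₀ hUP₀)
    (mul_nonneg (one_half_pos (α := ℝ)).le hUN₀) hε
  obtain ⟨c, hc, hc1, hc2⟩ := exists_balancing_scale
    (mul_nonneg hB₀ (add_nonneg hCP₀ hε.le)) (mul_nonneg zero_le_two (add_nonneg hCN₀ hε.le)) hε
  let p : 𝒟 → Q.Space := fun x => Q.combine x (fun v => √(σ v) * a)
    (fun e => g x e * √(Q.r e) * b) (fun v => ν x v / √(σ v + Q.stationary v) * c)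
    (fun v => (Q.setup v).posWitness x) (fun e => (Q.update e).posWitness x) fun v D => wp v D x
  let n : 𝒟 → Q.Space := fun y => Q.combine y (fun v => √(σ v) * a⁻¹)
    (fun e => (√(Q.r e))⁻¹ * b⁻¹) (fun v => √(σ v + Q.stationary v) * c⁻¹)
    (fun v => (Q.setup v).negWitness y) (fun e => (Q.update e).negWitness y) fun v D => wn v D y
  have hpn : ∀ x y, (Q.marked x).Nonempty → ¬ (Q.marked y).Nonempty →
      inner ℂ (p x) (n y) = 1 := by
    intro x y hx hy
    refine inner_combine_eq_one hσ.2 (hg x hx) (fun v => ?_) (fun e => ?_) (fun v => ?_)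
      fun v hv hxy => SpanProgram.inner_eq_one (hwp v _ x rfl (hν' x hx v hv)).1
        (hwn v _ y hxy (hunmarked y hy v)).1
    · rw [mul_mul_mul_comm, Real.mul_self_sqrt (hσ.1 v), mul_inv_cancel₀ ha.ne', mul_one]
    · have := (Real.sqrt_pos.2 (Q.r_pos e)).ne'
      field_simp
    · have := (Real.sqrt_pos.2 (hκ v)).ne'
      field_simp
  have hp : ∀ x, (Q.marked x).Nonempty → ‖p x‖ ^ 2 ≤
      a ^ 2 * SP + (b ^ 2 * (A * UP) + c ^ 2 * (B * (CP + ε))) := by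
    intro x hx
    rw [sq_norm_combine]
    refine add_le_add ?_ (add_le_add ?_ ?_)
    · calc _ ≤ ∑ v, σ v * (a ^ 2 * SP) := Finset.sum_le_sum fun v _ => by
            rw [mul_pow, Real.sq_sqrt (hσ.1 v), mul_assoc]
            exact mul_le_mul_of_nonneg_left
              (mul_le_mul_of_nonneg_left (hSP v x) (sq_nonneg a)) (hσ.1 v)
        _ = _ := by rw [← Finset.sum_mul, hσ.2, one_mul]
    · calc _ ≤ ∑ e, g x e ^ 2 * Q.r e * (b ^ 2 * UP) := Finset.sum_le_sum fun e _ => by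
            rw [mul_pow, mul_pow, Real.sq_sqrt (Q.r_pos e).le, mul_assoc _ (b ^ 2)]
            exact mul_le_mul_of_nonneg_left (mul_le_mul_of_nonneg_left (hUP e x) (sq_nonneg b))
              (mul_nonneg (sq_nonneg _) (Q.r_pos e).le)
        _ ≤ A * (b ^ 2 * UP) := by
            rw [← Finset.sum_mul]
            exact mul_le_mul_of_nonneg_right (hA x hx) (mul_nonneg (sq_nonneg b) hUP₀)
        _ = _ := by ring
    · calc _ ≤ ∑ v, ν x v ^ 2 / (σ v + Q.stationary v) * (c ^ 2 * (CP + ε)) :=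
            Finset.sum_le_sum fun v _ => by
              rw [mul_pow, div_pow, Real.sq_sqrt (hκ v).le, mul_assoc]
              by_cases hv : ν x v = 0
              · simp [hv]
              · exact mul_le_mul_of_nonneg_left (mul_le_mul_of_nonneg_left
                  (hwp v _ x rfl (hν' x hx v hv)).2 (sq_nonneg c))
                  (div_nonneg (sq_nonneg _) (hκ v).le)
        _ ≤ B * (c ^ 2 * (CP + ε)) := by
            rw [← Finset.sum_mul]
            exact mul_le_mul_of_nonneg_right (hB x hx)
              (mul_nonneg (sq_nonneg c) (add_nonneg hCP₀ hε.le))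
        _ = _ := by ring
  have hn : ∀ y, ¬ (Q.marked y).Nonempty → ‖n y‖ ^ 2 ≤
      a⁻¹ ^ 2 * SN + (b⁻¹ ^ 2 * (1 / 2 * UN) + c⁻¹ ^ 2 * (2 * (CN + ε))) := by
    intro y hy
    rw [sq_norm_combine]
    refine add_le_add ?_ (add_le_add ?_ ?_)
    · calc _ ≤ ∑ v, σ v * (a⁻¹ ^ 2 * SN) := Finset.sum_le_sum fun v _ => by
            rw [mul_pow, Real.sq_sqrt (hσ.1 v), mul_assoc]
            exact mul_le_mul_of_nonneg_left
              (mul_le_mul_of_nonneg_left (hSN v y) (sq_nonneg _)) (hσ.1 v)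
        _ = _ := by rw [← Finset.sum_mul, hσ.2, one_mul]
    · calc _ ≤ ∑ e, (Q.r e)⁻¹ * (b⁻¹ ^ 2 * UN) := Finset.sum_le_sum fun e _ => by
            rw [mul_pow, inv_pow (√(Q.r e)), Real.sq_sqrt (Q.r_pos e).le, mul_assoc]
            exact mul_le_mul_of_nonneg_left (mul_le_mul_of_nonneg_left (hUN e y) (sq_nonneg _))
              (inv_pos.2 (Q.r_pos e)).le
        _ = _ := by rw [← Finset.sum_mul, Q.sum_inv_r]; ring
    · calc _ ≤ ∑ v, (σ v + Q.stationary v) * (c⁻¹ ^ 2 * (CN + ε)) :=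
            Finset.sum_le_sum fun v _ => by
              rw [mul_pow, Real.sq_sqrt (hκ v).le, mul_assoc]
              exact mul_le_mul_of_nonneg_left (mul_le_mul_of_nonneg_left
                (hwn v _ y rfl (hunmarked y hy v)).2 (sq_nonneg _)) (hκ v).le
        _ = _ := by
            have : ∑ v, (σ v + Q.stationary v) = 2 := by
              rw [Finset.sum_add_distrib, hσ.2, stationary,
                MultiGraph.sum_stationary Q.connected Q.r_pos]
              norm_num
            rw [← Finset.sum_mul, this]
            ring
  obtain ⟨P, hP1, hP2, hP3⟩ := SpanProgram.exists_of_witnesses Q.inputSpace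
    (fun x => (Q.marked x).Nonempty) p n (p x₀)
    (fun x hx => combine_mem_inputSpace fun v hv =>
      (hwp v _ x rfl (hν' x hx v fun h => hv (by simp [h]))).1.1)
    (fun y hy => combine_mem_inputSpace_orthogonal fun v =>
      (hwn v _ y rfl (hunmarked y hy v)).1.1) hpn (fun y hy => hpn x₀ y hx₀ hy)
  refine ⟨P, hP1, hP2, hP3 _ (by positivity) (fun x hx => ?_) (fun y hy => ?_)⟩
  · linarith [hp x hx]
  · linarith [hn y hy]

/-- If both answers occur, then some routine has to work: at a vertex that is marked for one input
and unmarked for another one, the inputs are told apart by the checking routine if their database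
entries agree, and by the setup routine otherwise. -/
theorem one_le_setupCost_or_one_le_checkCost [Finite 𝒟] {x y : 𝒟} (hx : (Q.marked x).Nonempty)
    (hy : ¬ (Q.marked y).Nonempty) : 1 ≤ Q.setupCost ∨ 1 ≤ Q.checkCost := by
  obtain ⟨v, hv⟩ := hx
  by_cases h : Q.entry v x = Q.entry v y
  · right
    rw [checkCost, Real.one_le_sqrt]
    have h1 := (Q.check_correct v _ x rfl).1 hv
    have h2 := (Q.check_correct v _ y h).2 fun hv' => hy ⟨v, hv'⟩
    have h3 : (Q.check v (Q.entry v x)).negSize y ≤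
        ⨆ v, ⨆ x, (Q.check v (Q.entry v x)).negSize x := by
      rw [h]
      exact le_iSup_iSup_of_finite (fun v x => (Q.check v (Q.entry v x)).negSize x) v y
    exact (SpanProgram.one_le_posSize_mul_negSize h1 h2).trans (mul_le_mul
      (le_iSup_iSup_of_finite (fun v x => (Q.check v (Q.entry v x)).posSize x) v x) h3
      (SpanProgram.negSize_nonneg _ _)
      (Real.iSup_nonneg fun v => Real.iSup_nonneg fun x => SpanProgram.posSize_nonneg _ x))
  · left
    rw [setupCost, Real.one_le_sqrt]
    have h1 := norm_inner_le_norm (𝕜 := ℂ) ((Q.setup v).posWitness x) ((Q.setup v).negWitness y)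
    rw [inner_setup, if_neg h, sub_zero, norm_one] at h1
    have h2 : 1 ≤ (Q.setup v).posSize x * (Q.setup v).negSize y := by
      rw [StateReflection.Solution.posSize, StateReflection.Solution.negSize, ← mul_pow]
      exact one_le_pow₀ h1
    exact h2.trans (mul_le_mul
      (le_iSup_iSup_of_finite (fun v x => (Q.setup v).posSize x) v x)
      (le_iSup_iSup_of_finite (fun v x => (Q.setup v).negSize x) v y)
      ((Q.setup v).negSize_nonneg y)
      (Real.iSup_nonneg fun v => Real.iSup_nonneg fun x => (Q.setup v).posSize_nonneg x))

theorem setupCost_nonneg (Q : QuantumWalkSearch V E 𝒟 𝒮 MS WS MU WU HC) : 0 ≤ Q.setupCost :=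
  Real.sqrt_nonneg _

theorem updateCost_nonneg (Q : QuantumWalkSearch V E 𝒟 𝒮 MS WS MU WU HC) : 0 ≤ Q.updateCost :=
  Real.sqrt_nonneg _

theorem checkCost_nonneg (Q : QuantumWalkSearch V E 𝒟 𝒮 MS WS MU WU HC) : 0 ≤ Q.checkCost :=
  Real.sqrt_nonneg _

end QuantumWalkSearch

theorem mainTheorem3 :
    ∃ c : ℝ, 0 < c ∧
      ∀ (V E 𝒟 𝒮 : Type*) [Fintype V] [DecidableEq V] [Fintype E] [Fintype 𝒟] [Fintype 𝒮]
        (MS WS : V → Type*) (MU WU : E → Type*) (HC : V → 𝒮 → Type*)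
        [∀ v, NormedAddCommGroup (MS v)] [∀ v, InnerProductSpace ℂ (MS v)]
        [∀ v, FiniteDimensional ℂ (MS v)]
        [∀ v, NormedAddCommGroup (WS v)] [∀ v, InnerProductSpace ℂ (WS v)]
        [∀ e, NormedAddCommGroup (MU e)] [∀ e, InnerProductSpace ℂ (MU e)]
        [∀ e, FiniteDimensional ℂ (MU e)]
        [∀ e, NormedAddCommGroup (WU e)] [∀ e, InnerProductSpace ℂ (WU e)]
        [∀ v D, NormedAddCommGroup (HC v D)] [∀ v D, InnerProductSpace ℂ (HC v D)]
        (Q : QuantumWalkSearch V E 𝒟 𝒮 MS WS MU WU HC)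
        (σ : V → ℝ) (_hσ : σ ∈ stdSimplex ℝ V)
        (t : ℕ) (_ht : 1 ≤ t) (R : ℝ) (_hR : 0 ≤ R)
        (_hReff : ∀ x, (Q.marked x).Nonempty →
          markovResistanceToSet (Q.walk ^ t) Q.stationary σ (Q.marked x) ≤ ENNReal.ofReal R),
        ∃ P : SpanProgram 𝒟 Q.Space,
          (∀ x, P.inputSpace x = Q.inputSpace x) ∧
          P.Computes (fun x => (Q.marked x).Nonempty) ∧
          P.complexity ≤
            c * (Q.setupCost + √(t * R) * Q.updateCost + √(1 + R) * Q.checkCost) := by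
  refine ⟨4, by norm_num, ?_⟩
  intro V E 𝒟 𝒮 _ _ _ _ _ MS WS MU WU HC _ _ _ _ _ _ _ _ _ _ _ _ Q σ hσ t _ R hR hReff
  have hS := Q.setupCost_nonneg
  have hU := mul_nonneg (Real.sqrt_nonneg (t * R)) Q.updateCost_nonneg
  have hC := Q.checkCost_nonneg
  have hR1 : 1 ≤ √(1 + R) := Real.one_le_sqrt.2 (by linarith)
  have hC' := mul_nonneg (zero_le_one.trans hR1) hC
  by_cases hall : ∀ x, (Q.marked x).Nonempty
  · obtain ⟨P, hP1, hP2, -⟩ := SpanProgram.exists_of_witnesses Q.inputSpace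
      (fun x => (Q.marked x).Nonempty) (fun _ => 0) (fun _ => 0) 0 (fun x _ => zero_mem _)
      (fun x _ => zero_mem _) (fun _ y _ hy => absurd (hall y) hy) (fun y hy => absurd (hall y) hy)
    refine ⟨P, fun x => by rw [hP1], hP2, ?_⟩
    rw [hP2.complexity_eq_zero_of_forall hall]
    linarith
  by_cases hnone : ∀ x, ¬ (Q.marked x).Nonempty
  · obtain ⟨P, hP1, hP2⟩ := QuantumWalkSearch.exists_spanProgram_of_forall_not hnone
    refine ⟨P, fun x => by rw [hP1], hP2, ?_⟩
    rw [hP2.complexity_eq_zero_of_forall_not hnone]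
    linarith
  push Not at hall hnone
  obtain ⟨y₀, hy₀⟩ := hall
  have hx₀ := hnone
  obtain ⟨x₀, hx₀'⟩ := hnone
  -- the bound is at least `1`, which leaves room for witnesses and flows that are almost optimal
  have hT : 1 ≤ Q.setupCost + √(t * R) * Q.updateCost + √(1 + R) * Q.checkCost := by
    rcases QuantumWalkSearch.one_le_setupCost_or_one_le_checkCost hx₀'
      (Set.not_nonempty_iff_eq_empty.2 hy₀) with h | h
    · linarith
    · have := one_le_mul_of_one_le_of_one_le hR1 h
      linarith
  set SP := ⨆ v, ⨆ x, (Q.setup v).posSize x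
  set SN := ⨆ v, ⨆ x, (Q.setup v).negSize x
  set UP := ⨆ e, ⨆ x, (Q.update e).posSize x
  set UN := ⨆ e, ⨆ x, (Q.update e).negSize x
  set CP := ⨆ v, ⨆ x, (Q.check v (Q.entry v x)).posSize x
  set CN := ⨆ v, ⨆ x, (Q.check v (Q.entry v x)).negSize x
  let φ : ℝ → ℝ := fun ε => √(SP * SN) + √(2 * (t * (R + ε)) * UP * (1 / 2 * UN)) +
    √((2 + 4 * (R + ε)) * (CP + ε) * (2 * (CN + ε))) + 3 * ε
  have hφ₀ : φ 0 < 4 * (Q.setupCost + √(t * R) * Q.updateCost + √(1 + R) * Q.checkCost) := by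
    have h1 : √(2 * (t * (R + 0)) * UP * (1 / 2 * UN)) = √(t * R) * Q.updateCost := by
      rw [QuantumWalkSearch.updateCost, ← Real.sqrt_mul (mul_nonneg t.cast_nonneg hR)]
      congr 1
      ring
    have h2 : √((2 + 4 * (R + 0)) * (CP + 0) * (2 * (CN + 0))) ≤
        3 * (√(1 + R) * Q.checkCost) := by
      have h3 : (0 : ℝ) ≤ CP * CN := mul_nonneg
        (Real.iSup_nonneg fun v => Real.iSup_nonneg fun x => SpanProgram.posSize_nonneg _ x)
        (Real.iSup_nonneg fun v => Real.iSup_nonneg fun x => SpanProgram.negSize_nonneg _ x)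
      rw [Real.sqrt_le_left (by positivity), mul_pow, mul_pow, Real.sq_sqrt (by linarith),
        QuantumWalkSearch.checkCost, Real.sq_sqrt h3]
      nlinarith [mul_nonneg h3 hR]
    have h4 : √(SP * SN) = Q.setupCost := rfl
    simp only [φ]
    linarith
  have hφ : Continuous φ := by fun_prop
  obtain ⟨ε, hlt, hε⟩ := ((((hφ.tendsto 0).mono_left nhdsWithin_le_nhds).eventually_lt_const
    hφ₀).and (self_mem_nhdsWithin (s := Set.Ioi (0 : ℝ)))).exists
  have hε : 0 < ε := hε
  have hflow : ∀ x, ∃ (ν : V → ℝ) (g : E → ℝ), (Q.marked x).Nonempty →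
      (∀ v ∉ Q.marked x, ν v = 0) ∧ Q.G.netFlow g = σ - ν ∧
      ∑ e, g e ^ 2 * Q.r e ≤ 2 * (t * (R + ε)) ∧
      ∑ v, ν v ^ 2 / (σ v + Q.stationary v) ≤ 2 + 4 * (R + ε) := by
    intro x
    by_cases hx : (Q.marked x).Nonempty
    · obtain ⟨ν, -, h1, ⟨g, h2, h3⟩, h4⟩ := MultiGraph.exists_flow_of_markovResistanceToSet_le
        Q.connected Q.r_pos Q.sum_inv_r hσ hR (lt_add_of_pos_right R hε) (hReff x hx)
      exact ⟨ν, g, fun _ => ⟨h1, h2, h3, h4⟩⟩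
    · exact ⟨0, 0, fun h => absurd h hx⟩
  choose ν g hνg using hflow
  obtain ⟨P, hP1, hP2, hP3⟩ := QuantumWalkSearch.exists_spanProgram_complexity_le hσ
    (fun x hx => (hνg x hx).1) (fun x hx => (hνg x hx).2.1) (fun x hx => (hνg x hx).2.2.1)
    (fun x hx => (hνg x hx).2.2.2) hx₀ hε
  exact ⟨P, fun x => by rw [hP1], hP2, hP3.trans hlt.le⟩
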